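/- Let $\Omega\subset\mathbb R^2$ be a bounded open set which either has $\mathcal C^\infty$ boundary or is an open square, let $x_0\in\Omega$ and $\varepsilon>0$ be such that $\overline{B(x_0,\varepsilon)}\subset\Omega$, and put $$f_\varepsilon=\frac{2}{\sigma(\mathbb S_1)\,\varepsilon^2}\mathbf 1_{B(x_0,\varepsilon)}=\frac{1}{\pi\varepsilon^2}\mathbf 1_{B(x_0,\varepsilon)},$$ where $B(x_0,\varepsilon)$ is the open ball and $\sigma(\mathbb S_1)=2\pi$ is the length of the unit circle. Let $p\in[1,2)$ and let $u_\delta\in W^{1,p}_0(\Omega)$ be the variational solution of $-\Delta u_\delta=\delta_{x_0}$ in $\Omega$, $u_\delta=0$ on $\partial\Omega$, that is, $\int_\Omega\nabla u_\delta\cdot\nabla\varphi=\varphi(x_0)$ for all $\varphi\in\mathcal C_c^\infty(\Omega)$. Let $u_\varepsilon\in H^1_0(\Omega)$ be the variational solution of $-\Delta u_\varepsilon=f_\varepsilon$ in $\Omega$, $u_\varepsilon=0$ on $\partial\Omega$, that is, $\int_\Omega\nabla u_\varepsilon\cdot\nabla\varphi=\int_\Omega f_\varepsilon\varphi$ for all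 $\varphi\in\mathcal C_c^\infty(\Omega)$. Then $u_\delta$ and $u_\varepsilon$ coincide on $\overline\Omega\setminus B(x_0,\varepsilon)$. More precisely, $u_\delta$ and $u_\varepsilon$ have representatives (for equality almost everywhere in $\Omega$) which are continuous on $\overline\Omega\setminus B(x_0,\varepsilon)$, vanish on $\partial\Omega$, and are equal at every point of $\overline\Omega\setminus B(x_0,\varepsilon)$. -/

import Mathlib

open MeasureTheory Filter Topology
open scoped Distributions Gradient ENNReal ContDiff

/-- The Euclidean plane. -/
abbrev Plane : Type := EuclideanSpace ℝ (Fin 2)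

/-- Open sets with `C^∞` boundary: near every boundary point `q`, the set is `{ρ < 0}` for a smooth
function `ρ` whose differential at `q` does not vanish. -/
def HasSmoothBoundary (Ω : Set Plane) : Prop :=
  ∀ q ∈ frontier Ω, ∃ ρ : Plane → ℝ,
    ContDiff ℝ ∞ ρ ∧ fderiv ℝ ρ q ≠ 0 ∧ ∀ᶠ x in 𝓝 q, (x ∈ Ω ↔ ρ x < 0)

/-- Open squares, in arbitrary position: centre `c`, half side `L`, sides parallel to the vectors of
an orthonormal basis `b`. -/
def IsOpenSquare (Ω : Set Plane) : Prop :=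
  ∃ (c : Plane) (b : OrthonormalBasis (Fin 2) ℝ Plane) (L : ℝ),
    0 < L ∧ Ω = {x | ∀ i, |b.repr (x - c) i| < L}

/-- `u ∈ W^{1,p}(Ω)` with weak gradient `g`. Only the values of `u` and `g` in `Ω` matter, up to
null sets. -/
structure HasSobolevGradient (p : ℝ≥0∞) (Ω : TopologicalSpace.Opens Plane)
    (u : Plane → ℝ) (g : Plane → Plane) : Prop where
  memLp : MemLp u p (volume.restrict (Ω : Set Plane))
  memLp_grad : MemLp g p (volume.restrict (Ω : Set Plane))
  weak_grad : ∀ (φ : 𝓓(Ω, ℝ)) (e : Plane),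
    ∫ x in (Ω : Set Plane), u x * fderiv ℝ φ x e
      = - ∫ x in (Ω : Set Plane), inner ℝ (g x) e * φ x

/-- `u ∈ W_0^{1,p}(Ω)` with weak gradient `g`: the function `u` belongs to the closure of
`C_c^∞(Ω)` in `W^{1,p}(Ω)`. -/
structure HasSobolevZeroGradient (p : ℝ≥0∞) (Ω : TopologicalSpace.Opens Plane)
    (u : Plane → ℝ) (g : Plane → Plane) : Prop extends HasSobolevGradient p Ω u g where
  approx : ∃ φ : ℕ → 𝓓(Ω, ℝ),
    Tendsto (fun n => eLpNorm (fun x => φ n x - u x) p (volume.restrict (Ω : Set Plane)))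
      atTop (𝓝 0) ∧
    Tendsto (fun n => eLpNorm (fun x => ∇ (φ n) x - g x) p (volume.restrict (Ω : Set Plane)))
      atTop (𝓝 0)

/-- `u ∈ W_0^{1,p}(Ω)` is a variational solution of `-Δu = δ_{x₀}` in `Ω`, `u = 0` on `∂Ω`. -/
def IsDiracSolution (p : ℝ≥0∞) (Ω : TopologicalSpace.Opens Plane) (x₀ : Plane)
    (u : Plane → ℝ) : Prop :=
  ∃ g : Plane → Plane, HasSobolevZeroGradient p Ω u g ∧
    ∀ φ : 𝓓(Ω, ℝ), ∫ x in (Ω : Set Plane), inner ℝ (g x) (∇ φ x) = φ x₀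

/-- `u ∈ H_0^1(Ω)` is a variational solution of `-Δu = f` in `Ω`, `u = 0` on `∂Ω`. -/
def IsPoissonSolution (Ω : TopologicalSpace.Opens Plane) (f : Plane → ℝ)
    (u : Plane → ℝ) : Prop :=
  ∃ g : Plane → Plane, HasSobolevZeroGradient 2 Ω u g ∧
    ∀ φ : 𝓓(Ω, ℝ), ∫ x in (Ω : Set Plane), inner ℝ (g x) (∇ φ x)
      = ∫ x in (Ω : Set Plane), f x * φ x

/-- The normalized indicator `d / (σ(S_{d-1}) ε^d) 1_{B(x₀,ε)}` in dimension `d = 2`, where the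
unit circle has length `σ(S_1) = 2π`. -/
noncomputable def ballBump (x₀ : Plane) (ε : ℝ) : Plane → ℝ :=
  (Metric.ball x₀ ε).indicator (fun _ => 2 / (2 * Real.pi * ε ^ 2))

/-! Outside a disc, a uniform mass on the disc has the same potential as a Dirac mass at its centre.
Here this takes the form of an integrable function $w$, zero off $B(x_0,\varepsilon)$, with $\Delta
w=f_\varepsilon-\delta_{x_0}$ in the sense of distributions (`exists_potential_ballBump`). Hence
$u_\varepsilon+w$ satisfies $-\Delta(u_\varepsilon+w)=\delta_{x_0}$ and has the same boundary
behaviour as $u_\varepsilon$. Uniqueness gives $u_\delta=u_\varepsilon+w$ almost everywhere in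
$\Omega$, so $u_\delta=u_\varepsilon$ almost everywhere off the ball. The function $w$ comes from
integrating over $r$ the derivative of the dilated means $\int B(z)\psi(rz)\,dz$
(`KernelPair.integral_potential_mul_lap`), so no logarithm appears.

Uniqueness cannot rest on an energy argument, because the difference is only handled as an
integrable function that is harmonic in the sense of distributions. It is smooth by Weyl's lemma
(`WeaklyHarmonic.exists_harmonic`), proved with a compactly supported parametrix of the same
dilation type. What remains is to turn "belongs to $W^{1,p}_0$" into pointwise decay at the
boundary.

The geometry of $\Omega$ enters only through a barrier $\varphi$ (`IsBarrier`): smooth, positive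
inside, zero on the boundary, strictly superharmonic near it. Membership in $W^{1,p}_0$ is used as
the statement that weighted integrals of $|u|$ over the layers $\{t\le\varphi\le 2t\}$ tend to $0$
(`HasSobolevZeroGradient.zeroTrace`). For a function harmonic near the boundary, Green's identity
against a truncation of $\varphi$ upgrades this to $|h|\le C\varphi$
(`IsBarrier.abs_le_mul_of_zeroTrace`). This bound feeds the maximum principle
(`IsBarrier.nonpos_of_le_mul`), hence uniqueness, and it also gives continuity up to the boundary
with value zero (`IsBarrier.exists_continuousOn_of_weaklyHarmonic`). -/

/-! ### Calculus of partial derivatives and of the Laplacian -/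

/-- The `i`-th partial derivative. -/
noncomputable def pd (i : Fin 2) (f : Plane → ℝ) (x : Plane) : ℝ :=
  fderiv ℝ f x (EuclideanSpace.single i 1)

/-- The Laplacian. -/
noncomputable def lap (f : Plane → ℝ) (x : Plane) : ℝ := ∑ i, pd i (pd i f) x

theorem ContDiffAt.pderiv {f : Plane → ℝ} {x : Plane} {m n : WithTop ℕ∞} (hf : ContDiffAt ℝ n f x)
    (hmn : m + 1 ≤ n) (i : Fin 2) : ContDiffAt ℝ m (pd i f) x :=
  (hf.fderiv_right hmn).clm_apply contDiffAt_const

theorem ContDiff.pderiv {f : Plane → ℝ} {m n : WithTop ℕ∞} (hf : ContDiff ℝ n f)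
    (hmn : m + 1 ≤ n) (i : Fin 2) : ContDiff ℝ m (pd i f) :=
  contDiff_iff_contDiffAt.2 fun _ => hf.contDiffAt.pderiv hmn i

theorem ContDiff.pderiv_infty {f : Plane → ℝ} (hf : ContDiff ℝ ∞ f) (i : Fin 2) :
    ContDiff ℝ ∞ (pd i f) := hf.pderiv (by simp) i

theorem ContDiff.laplacian_infty {f : Plane → ℝ} (hf : ContDiff ℝ ∞ f) : ContDiff ℝ ∞ (lap f) :=
  ContDiff.sum fun i _ => (hf.pderiv_infty i).pderiv_infty i

theorem ContDiffAt.continuousAt_lap {f : Plane → ℝ} {x : Plane} (hf : ContDiffAt ℝ 2 f x) :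
    ContinuousAt (lap f) x :=
  tendsto_finsetSum _ fun i _ => ((hf.pderiv (m := 1) (by norm_num) i).pderiv (m := 0)
    (by norm_num) i).continuousAt

theorem Filter.EventuallyEq.pderiv {f g : Plane → ℝ} {x : Plane} (h : f =ᶠ[𝓝 x] g) (i : Fin 2) :
    pd i f =ᶠ[𝓝 x] pd i g := (h.fderiv (𝕜 := ℝ)).mono fun y hy => by simp only [pd, hy]

theorem Filter.EventuallyEq.laplacian {f g : Plane → ℝ} {x : Plane} (h : f =ᶠ[𝓝 x] g) :
    lap f =ᶠ[𝓝 x] lap g := by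
  have := eventually_all.2 fun i => Filter.EventuallyEq.pderiv (Filter.EventuallyEq.pderiv h i) i
  filter_upwards [this] with y hy
  simp only [lap, hy]

theorem tsupport_pd_subset (i : Fin 2) (f : Plane → ℝ) : tsupport (pd i f) ⊆ tsupport f :=
  tsupport_fderiv_apply_subset ℝ _

theorem pd_eq_zero_of_notMem {f : Plane → ℝ} {x : Plane} (hx : x ∉ tsupport f) (i : Fin 2) :
    pd i f x = 0 := image_eq_zero_of_notMem_tsupport fun h => hx (tsupport_pd_subset i f h)

theorem lap_eq_zero_of_notMem {f : Plane → ℝ} {x : Plane} (hx : x ∉ tsupport f) :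
    lap f x = 0 :=
  Finset.sum_eq_zero fun i _ => pd_eq_zero_of_notMem (fun h => hx (tsupport_pd_subset i f h)) i

theorem pd_mul {f g : Plane → ℝ} {x : Plane} (hf : DifferentiableAt ℝ f x)
    (hg : DifferentiableAt ℝ g x) (i : Fin 2) :
    pd i (fun y => f y * g y) x = f x * pd i g x + g x * pd i f x := by
  simp [pd, fderiv_fun_mul hf hg]

theorem pd_add {f g : Plane → ℝ} {x : Plane} (hf : DifferentiableAt ℝ f x)
    (hg : DifferentiableAt ℝ g x) (i : Fin 2) :
    pd i (fun y => f y + g y) x = pd i f x + pd i g x := by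
  simp [pd, fderiv_fun_add hf hg]

theorem pd_comp {b : ℝ → ℝ} {f : Plane → ℝ} {x : Plane} (hb : DifferentiableAt ℝ b (f x))
    (hf : DifferentiableAt ℝ f x) (i : Fin 2) :
    pd i (fun y => b (f y)) x = deriv b (f x) * pd i f x := by
  have : HasFDerivAt (fun y => b (f y)) (deriv b (f x) • fderiv ℝ f x) x :=
    hb.hasDerivAt.comp_hasFDerivAt x hf.hasFDerivAt
  simp [pd, this.fderiv]

theorem lap_add {f g : Plane → ℝ} {x : Plane} (hf : ContDiffAt ℝ 2 f x)
    (hg : ContDiffAt ℝ 2 g x) : lap (fun y => f y + g y) x = lap f x + lap g x := by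
  simp only [lap, ← Finset.sum_add_distrib]
  refine Finset.sum_congr rfl fun i _ => ?_
  have : pd i (fun y => f y + g y) =ᶠ[𝓝 x] fun y => pd i f y + pd i g y := by
    filter_upwards [hf.eventually (by simp), hg.eventually (by simp)] with y h1 h2
    exact pd_add (h1.differentiableAt (by simp)) (h2.differentiableAt (by simp)) i
  rw [(this.pderiv i).eq_of_nhds, pd_add
    ((hf.pderiv (m := 1) (by norm_num) i).differentiableAt (by simp))
    ((hg.pderiv (m := 1) (by norm_num) i).differentiableAt (by simp))]

theorem lap_const_mul {f : Plane → ℝ} {x : Plane} (c : ℝ) (hf : ContDiffAt ℝ 2 f x) :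
    lap (fun y => c * f y) x = c * lap f x := by
  simp only [lap, Finset.mul_sum]
  refine Finset.sum_congr rfl fun i _ => ?_
  have : pd i (fun y => c * f y) =ᶠ[𝓝 x] fun y => c * pd i f y := by
    filter_upwards [hf.eventually (by simp)] with y h1
    simp [pd, fderiv_const_mul (h1.differentiableAt (by simp))]
  rw [(this.pderiv i).eq_of_nhds]
  have := fderiv_const_mul ((hf.pderiv (m := 1) (by norm_num) i).differentiableAt (by simp)) c
  change fderiv ℝ (fun y => c * pd i f y) x _ = c * fderiv ℝ (pd i f) x _
  rw [this]
  rfl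

theorem lap_mul {f g : Plane → ℝ} {x : Plane} (hf : ContDiffAt ℝ 2 f x)
    (hg : ContDiffAt ℝ 2 g x) : lap (fun y => f y * g y) x =
      f x * lap g x + g x * lap f x + 2 * ∑ i, pd i f x * pd i g x := by
  simp only [lap, Finset.mul_sum, ← Finset.sum_add_distrib]
  refine Finset.sum_congr rfl fun i _ => ?_
  have : pd i (fun y => f y * g y) =ᶠ[𝓝 x] fun y => f y * pd i g y + g y * pd i f y := by
    filter_upwards [hf.eventually (by simp), hg.eventually (by simp)] with y h1 h2
    exact pd_mul (h1.differentiableAt (by simp)) (h2.differentiableAt (by simp)) i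
  have hf' := hf.differentiableAt (by simp)
  have hg' := hg.differentiableAt (by simp)
  have hfi := (hf.pderiv (m := 1) (by norm_num) i).differentiableAt (by simp)
  have hgi := (hg.pderiv (m := 1) (by norm_num) i).differentiableAt (by simp)
  rw [(this.pderiv i).eq_of_nhds, pd_add (hf'.fun_mul hgi) (hg'.fun_mul hfi),
    pd_mul hf' hgi, pd_mul hg' hfi]
  ring

theorem lap_comp {b : ℝ → ℝ} {f : Plane → ℝ} {x : Plane} (hb : ContDiff ℝ 2 b)
    (hf : ContDiffAt ℝ 2 f x) : lap (fun y => b (f y)) x =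
      deriv (deriv b) (f x) * ∑ i, pd i f x ^ 2 + deriv b (f x) * lap f x := by
  simp only [lap, Finset.mul_sum, ← Finset.sum_add_distrib]
  refine Finset.sum_congr rfl fun i _ => ?_
  have hb1 : ContDiff ℝ 1 (deriv b) := by
    have : ContDiff ℝ (1 + 1) b := by norm_num; exact hb
    exact this.deriv'
  have : pd i (fun y => b (f y)) =ᶠ[𝓝 x] fun y => deriv b (f y) * pd i f y := by
    filter_upwards [hf.eventually (by simp)] with y h1
    exact pd_comp (hb.contDiffAt.differentiableAt (by simp)) (h1.differentiableAt (by simp)) i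
  have hf' := hf.differentiableAt (by simp)
  have hfi := (hf.pderiv (m := 1) (by norm_num) i).differentiableAt (by simp)
  have hb' : DifferentiableAt ℝ (deriv b) (f x) := hb1.contDiffAt.differentiableAt (by simp)
  rw [(this.pderiv i).eq_of_nhds, pd_mul (hb'.fun_comp' x hf') hfi, pd_comp hb' hf']
  ring

/-! ### Integration by parts and Green's identities -/

theorem integrable_mul_of_tsupport_subset {f g : Plane → ℝ} (hg : Continuous g)
    (hgc : HasCompactSupport g) (hf : ∀ x ∈ tsupport g, ContinuousAt f x) :
    Integrable (fun x => f x * g x) := by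
  have hfc : ContinuousOn (fun x => f x * g x) (tsupport g) := fun x hx =>
    ((hf x hx).mul hg.continuousAt).continuousWithinAt
  refine (integrableOn_iff_integrable_of_support_subset ?_).1 (hfc.integrableOn_compact hgc)
  exact fun x hx => subset_tsupport g fun h => hx (by simp [h])

theorem integral_mul_pd {f g : Plane → ℝ} (hg : ContDiff ℝ 1 g) (hgc : HasCompactSupport g)
    (hf : ∀ x ∈ tsupport g, ContDiffAt ℝ 1 f x) (i : Fin 2) :
    ∫ x, f x * pd i g x = - ∫ x, pd i f x * g x := by
  have hpc : HasCompactSupport (pd i g) := hgc.mono' (subset_tsupport _ |>.trans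
    (tsupport_pd_subset i g))
  refine integral_mul_fderiv_eq_neg_fderiv_mul_of_integrable ?_ ?_ ?_
    (fun x hx => (hf x hx).differentiableAt (by simp))
    (fun x _ => hg.contDiffAt.differentiableAt (by simp))
  · exact integrable_mul_of_tsupport_subset hg.continuous hgc fun x hx =>
      ((hf x hx).pderiv (m := 0) (by simp) i).continuousAt
  · exact integrable_mul_of_tsupport_subset (hg.pderiv (m := 0) (by simp) i).continuous hpc
      fun x hx => (hf x (tsupport_pd_subset i g hx)).continuousAt
  · exact integrable_mul_of_tsupport_subset hg.continuous hgc fun x hx => (hf x hx).continuousAt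

theorem HasCompactSupport.pderiv {g : Plane → ℝ} (hgc : HasCompactSupport g) (i : Fin 2) :
    HasCompactSupport (pd i g) :=
  hgc.mono' (subset_tsupport _ |>.trans (tsupport_pd_subset i g))

theorem HasCompactSupport.laplacian {g : Plane → ℝ} (hgc : HasCompactSupport g) :
    HasCompactSupport (lap g) :=
  hgc.mono' fun _ hx => by_contra fun h => hx (lap_eq_zero_of_notMem h)

/-- Green's first identity, one of the functions having compact support. -/
theorem integral_mul_lap_eq_neg_sum {f g : Plane → ℝ} (hg : ContDiff ℝ 2 g)
    (hgc : HasCompactSupport g) (hf : ∀ x ∈ tsupport g, ContDiffAt ℝ 1 f x) :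
    ∫ x, f x * lap g x = - ∫ x, ∑ i, pd i f x * pd i g x := by
  have h1 : ∀ i, ContDiff ℝ 1 (pd i g) := fun i => hg.pderiv (by norm_num) i
  have hpc : ∀ i, HasCompactSupport (pd i g) := fun i => hgc.pderiv i
  simp only [lap, Finset.mul_sum]
  rw [integral_finsetSum, integral_finsetSum, ← Finset.sum_neg_distrib]
  · exact Finset.sum_congr rfl fun i _ => integral_mul_pd (h1 i) (hpc i)
      (fun x hx => hf x (tsupport_pd_subset i g hx)) i
  · exact fun i _ => integrable_mul_of_tsupport_subset (h1 i).continuous (hpc i) fun x hx =>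
      ((hf x (tsupport_pd_subset i g hx)).pderiv (m := 0) (by simp) i).continuousAt
  · exact fun i _ => integrable_mul_of_tsupport_subset
      ((h1 i).pderiv (m := 0) (by simp) i).continuous
      ((hpc i).pderiv i) fun x hx =>
      (hf x (tsupport_pd_subset i g (tsupport_pd_subset i _ hx))).continuousAt

/-- Green's second identity, one of the functions having compact support. -/
theorem integral_mul_lap_comm {f g : Plane → ℝ} (hg : ContDiff ℝ 2 g)
    (hgc : HasCompactSupport g) (hf : ∀ x ∈ tsupport g, ContDiffAt ℝ 2 f x) :
    ∫ x, f x * lap g x = ∫ x, lap f x * g x := by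
  rw [integral_mul_lap_eq_neg_sum hg hgc fun x hx => (hf x hx).of_le (by norm_num)]
  have h1 : ∀ i, ∀ x ∈ tsupport g, ContDiffAt ℝ 1 (pd i f) x := fun i x hx =>
    (hf x hx).pderiv (by norm_num) i
  have hg1 : ContDiff ℝ 1 g := hg.of_le (by norm_num)
  simp only [lap, Finset.sum_mul]
  rw [integral_finsetSum, integral_finsetSum, ← Finset.sum_neg_distrib]
  · exact Finset.sum_congr rfl fun i _ => by rw [integral_mul_pd hg1 hgc (h1 i) i, neg_neg]
  · exact fun i _ => integrable_mul_of_tsupport_subset hg.continuous hgc fun x hx =>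
      ((h1 i x hx).pderiv (m := 0) (by simp) i).continuousAt
  · exact fun i _ => integrable_mul_of_tsupport_subset (hg1.pderiv (m := 0) (by simp) i).continuous
      (hgc.pderiv i) fun x hx => (h1 i x (tsupport_pd_subset i g hx)).continuousAt

/-! ### Potentials obtained by integrating over dilations -/

/-- A Lipschitz function `Q` and a density `B` on the closed unit disc, of total mass one, with
`∇Q = -z B(z)`. -/
structure KernelPair (Q B : Plane → ℝ) : Prop where
  lipschitz : ∃ C, LipschitzWith C Q
  eq_zero : ∀ z, 1 ≤ ‖z‖ → Q z = 0
  integrable : Integrable B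
  density_eq_zero : ∀ z, 1 < ‖z‖ → B z = 0
  lineDeriv_eq : ∀ i, ∀ᵐ z, lineDeriv ℝ Q z (EuclideanSpace.single i 1) = -(z i * B z)
  integral_eq_one : ∫ z, B z = 1

namespace KernelPair

variable {Q B : Plane → ℝ}

theorem continuous (h : KernelPair Q B) : Continuous Q :=
  let ⟨_, hC⟩ := h.lipschitz; hC.continuous

theorem hasCompactSupport (h : KernelPair Q B) : HasCompactSupport Q :=
  HasCompactSupport.intro (isCompact_closedBall (0 : Plane) 1) fun z hz =>
    h.eq_zero z (by simp at hz; exact hz.le)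

theorem integrable_left (h : KernelPair Q B) : Integrable Q :=
  h.continuous.integrable_of_hasCompactSupport h.hasCompactSupport

end KernelPair

theorem fderiv_apply_eq_sum_pd (f : Plane → ℝ) (x v : Plane) :
    fderiv ℝ f x v = ∑ i, v i * pd i f x := by
  have : v = ∑ i, v i • EuclideanSpace.single i (1 : ℝ) := by
    ext j
    fin_cases j <;> simp
  conv_lhs => rw [this]
  simp only [map_sum, map_smul, smul_eq_mul, pd]

theorem exists_bound_of_compactSupport {f : Plane → ℝ} (hf : Continuous f)
    (hc : HasCompactSupport f) : ∃ M, 0 ≤ M ∧ ∀ x, |f x| ≤ M := by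
  obtain ⟨M, hM⟩ := hf.bounded_above_of_compact_support hc
  exact ⟨M, (norm_nonneg _).trans (hM 0), hM⟩

namespace KernelPair

variable {Q B : Plane → ℝ} {ψ : Plane → ℝ}

theorem integrable_density_mul (h : KernelPair Q B) {g : Plane → ℝ} (hg : Continuous g) {M : ℝ}
    (hM : ∀ z, ‖z‖ ≤ 1 → |g z| ≤ M) : Integrable fun z => B z * g z := by
  refine (h.integrable.norm.mul_const M).mono'
    (h.integrable.aestronglyMeasurable.mul hg.aestronglyMeasurable) (ae_of_all _ fun z => ?_)
  rcases le_or_gt ‖z‖ 1 with hz | hz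
  · rw [norm_mul]
    exact mul_le_mul_of_nonneg_left (hM z hz) (norm_nonneg _)
  · simp [h.density_eq_zero z hz]

/-- Since $z_iB=-\partial_iQ$ almost everywhere, one integration by parts moves the derivative from
$Q$ to $\partial_i\psi(rz)$; the chain rule produces the factor $r$. Lipschitz regularity of $Q$
suffices, which is what the kernel of the disc requires. -/
theorem integral_density_mul_fderiv (h : KernelPair Q B) (hψ : ContDiff ℝ ∞ ψ)
    (hc : HasCompactSupport ψ) (r : ℝ) :
    ∫ z, B z * fderiv ℝ ψ (r • z) z = r * ∫ z, Q z * lap ψ (r • z) := by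
  obtain ⟨C, hC⟩ := h.lipschitz
  have key : ∀ i, ∫ z : Plane, B z * (z i * pd i ψ (r • z)) =
      ∫ z, Q z * (r * pd i (pd i ψ) (r • z)) := by
    intro i
    obtain ⟨D, hD⟩ := ContDiff.lipschitzWith_of_hasCompactSupport (hc.pderiv i)
      (hψ.pderiv_infty i) (by simp)
    have hg : LipschitzWith (D * ‖r‖₊) fun z => pd i ψ (r • z) :=
      hD.comp (lipschitzWith_smul r)
    have e := hg.integral_lineDeriv_mul_eq (μ := volume) hC h.hasCompactSupport
      (EuclideanSpace.single i (1 : ℝ))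
    have hl : ∀ z, lineDeriv ℝ (fun z => pd i ψ (r • z)) z (EuclideanSpace.single i (1 : ℝ)) =
        r * pd i (pd i ψ) (r • z) := by
      intro z
      have hd : HasFDerivAt (fun z : Plane => pd i ψ (r • z))
          ((fderiv ℝ (pd i ψ) (r • z)).comp (r • ContinuousLinearMap.id ℝ Plane)) z :=
        (((hψ.pderiv_infty i).contDiffAt.differentiableAt (by simp)).hasFDerivAt).comp z
          ((hasFDerivAt_id z).const_smul r)
      rw [hd.differentiableAt.lineDeriv_eq_fderiv, hd.fderiv]
      simp [pd]
    simp only [hl] at e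
    rw [integral_congr_ae (g := fun z => Q z * (r * pd i (pd i ψ) (r • z)))
      (ae_of_all _ fun z => mul_comm _ _)] at e
    rw [e]
    refine integral_congr_ae ?_
    filter_upwards [h.lineDeriv_eq i] with z hz
    rw [lineDeriv_neg, hz]
    ring
  have hcont : ∀ i, Continuous fun z : Plane => z i * pd i ψ (r • z) := fun i =>
    (by fun_prop : Continuous fun z : Plane => z i).mul
      ((hψ.pderiv_infty i).continuous.comp (continuous_const_smul r))
  simp only [fderiv_apply_eq_sum_pd, lap, Finset.mul_sum]
  rw [integral_finsetSum, integral_finsetSum, Finset.mul_sum]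
  · refine Finset.sum_congr rfl fun i _ => ?_
    rw [key i, ← integral_const_mul]
    exact integral_congr_ae (ae_of_all _ fun z => by ring)
  · intro i _
    refine (((h.continuous.mul (((hψ.pderiv_infty i).pderiv_infty i).continuous.comp
      (continuous_const_smul r))).integrable_of_hasCompactSupport
      (h.hasCompactSupport.mul_right)))
  · intro i _
    obtain ⟨M, hM0, hM⟩ := exists_bound_of_compactSupport (hψ.pderiv_infty i).continuous
      (hc.pderiv i)
    refine h.integrable_density_mul (hcont i) (M := 1 * M) fun z hz => ?_
    rw [abs_mul]
    exact mul_le_mul ((PiLp.norm_apply_le z i).trans hz) (hM _) (abs_nonneg _) zero_le_one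

/-- Differentiation under the integral is dominated because $B$ lives on $|z|\le1$, where
$|D\psi(rz)z|\le\sup\|D\psi\|$. -/
theorem hasDerivAt_mean (h : KernelPair Q B) (hψ : ContDiff ℝ ∞ ψ)
    (hc : HasCompactSupport ψ) (r : ℝ) :
    HasDerivAt (fun r => ∫ z, B z * ψ (r • z)) (r * ∫ z, Q z * lap ψ (r • z)) r := by
  rw [← h.integral_density_mul_fderiv hψ hc r]
  obtain ⟨M, hM0, hM⟩ := exists_bound_of_compactSupport hψ.continuous hc
  obtain ⟨N, hN⟩ := (hψ.continuous_fderiv (by simp)).bounded_above_of_compact_support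
    (hc.fderiv (𝕜 := ℝ))
  have hN0 : 0 ≤ N := (norm_nonneg _).trans (hN 0)
  have hi : ∀ r : ℝ, Integrable fun z => B z * ψ (r • z) := fun r =>
    h.integrable_density_mul (hψ.continuous.comp (continuous_const_smul r)) fun z _ => hM _
  have hfd : ∀ (r : ℝ) (z : Plane), ‖z‖ ≤ 1 → |fderiv ℝ ψ (r • z) z| ≤ N * 1 := fun r z hz =>
    ((fderiv ℝ ψ (r • z)).le_opNorm z).trans (mul_le_mul (hN _) hz (norm_nonneg _) hN0)
  have hfc : ∀ r : ℝ, Continuous fun z : Plane => fderiv ℝ ψ (r • z) z := fun r =>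
    ((hψ.continuous_fderiv (by simp)).comp (continuous_const_smul r)).clm_apply continuous_id
  refine (hasDerivAt_integral_of_dominated_loc_of_deriv_le (bound := fun z => ‖B z‖ * (N * 1))
    (F' := fun r z => B z * fderiv ℝ ψ (r • z) z) univ_mem
    (Eventually.of_forall fun r => (hi r).aestronglyMeasurable) (hi r)
    (h.integrable_density_mul (hfc r) (hfd r)).aestronglyMeasurable
    (ae_of_all _ fun z r _ => ?_) (h.integrable.norm.mul_const _)
    (ae_of_all _ fun z r _ => ?_)).2
  · rw [norm_mul]
    rcases le_or_gt ‖z‖ 1 with hz | hz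
    · exact mul_le_mul_of_nonneg_left (hfd r z hz) (norm_nonneg _)
    · simp [h.density_eq_zero z hz]
  · have h1 : HasDerivAt (fun r : ℝ => r • z) z r := by
      simpa using (hasDerivAt_id r).smul_const z
    exact ((hψ.differentiable (by simp) _).hasFDerivAt.comp_hasDerivAt r h1).const_mul (B z)

/-- The potential `∫₀^R Q(x/r) dr/r`. -/
noncomputable def potential (Q : Plane → ℝ) (R : ℝ) (x : Plane) : ℝ :=
  ∫ r in Set.Ioc 0 R, Q (r⁻¹ • x) / r

/-- By scaling in the plane, $\int|Q(x/r)|/r\,dx=r\int|Q|$, so the factor $1/r$ does no harm. This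
licenses Fubini for the potential. -/
theorem integrable_prod (h : KernelPair Q B) (R : ℝ) :
    Integrable (fun q : ℝ × Plane => Q (q.1⁻¹ • q.2) / q.1)
      ((volume.restrict (Set.Ioc 0 R)).prod volume) := by
  have hm : Measurable fun q : ℝ × Plane => Q (q.1⁻¹ • q.2) / q.1 :=
    (h.continuous.measurable.comp ((measurable_fst.inv).smul measurable_snd)).div measurable_fst
  rw [integrable_prod_iff hm.aestronglyMeasurable]
  constructor
  · refine (ae_restrict_iff' measurableSet_Ioc).2 (ae_of_all _ fun r hr => ?_)
    exact (h.integrable_left.comp_smul (inv_ne_zero hr.1.ne')).div_const r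
  · have e : ∀ r ∈ Set.Ioc 0 R, r * (∫ z, ‖Q z‖) = ∫ x, ‖Q (r⁻¹ • x) / r‖ := by
      intro r hr
      simp only [norm_div]
      rw [integral_div, Measure.integral_comp_inv_smul_of_nonneg volume (fun z => ‖Q z‖) hr.1.le]
      have := hr.1.ne'
      simp [abs_of_pos hr.1]
      field_simp
    refine Integrable.congr (f := fun r => r * ∫ z, ‖Q z‖) ?_
      ((ae_restrict_iff' measurableSet_Ioc).2 (ae_of_all _ e))
    have hid : IntegrableOn (fun r : ℝ => r) (Set.Ioc 0 R) := continuous_id.integrableOn_Ioc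
    exact Integrable.mul_const hid _

theorem integrable_potential (h : KernelPair Q B) (R : ℝ) : Integrable (potential Q R) :=
  (h.integrable_prod R).integral_prod_right

theorem potential_eq_zero (h : KernelPair Q B) {R : ℝ} {x : Plane} (hx : R ≤ ‖x‖) :
    potential Q R x = 0 := by
  refine setIntegral_eq_zero_of_forall_eq_zero fun r hr => ?_
  rw [h.eq_zero, zero_div]
  rw [norm_smul, norm_inv, Real.norm_of_nonneg hr.1.le, inv_mul_eq_div, one_le_div hr.1]
  exact hr.2.trans hx

/-- The distributional Laplacian of the potential is the rescaled density minus a Dirac mass. -/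
theorem integral_potential_mul_lap (h : KernelPair Q B) (hψ : ContDiff ℝ ∞ ψ)
    (hc : HasCompactSupport ψ) {R : ℝ} (hR : 0 ≤ R) :
    ∫ x, potential Q R x * lap ψ x = (∫ z, B z * ψ (R • z)) - ψ 0 := by
  obtain ⟨M, hM0, hM⟩ := exists_bound_of_compactSupport hψ.laplacian_infty.continuous hc.laplacian
  have hcont : Continuous fun r : ℝ => r * ∫ z, Q z * lap ψ (r • z) := by
    refine continuous_id.mul (continuous_of_dominated (bound := fun z => ‖Q z‖ * M)
      (fun r => ?_) (fun r => ae_of_all _ fun z => ?_) (h.integrable_left.norm.mul_const M)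
      (ae_of_all _ fun z => ?_))
    · exact (h.continuous.mul (hψ.laplacian_infty.continuous.comp
        (continuous_const_smul r))).aestronglyMeasurable
    · rw [norm_mul]
      exact mul_le_mul_of_nonneg_left (hM _) (norm_nonneg _)
    · exact continuous_const.mul (hψ.laplacian_infty.continuous.comp
        (continuous_id.smul continuous_const))
  -- The Dirac mass is the endpoint $r=0$, where the dilated mean equals $\psi(0)$ because $B$ has
  -- mass one.
  have hftc : ∫ r in (0 : ℝ)..R, r * ∫ z, Q z * lap ψ (r • z) =
      (∫ z, B z * ψ (R • z)) - ψ 0 := by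
    rw [intervalIntegral.integral_eq_sub_of_hasDerivAt (fun r _ => h.hasDerivAt_mean hψ hc r)
      (hcont.intervalIntegrable _ _)]
    simp [integral_mul_const, h.integral_eq_one]
  rw [← hftc, intervalIntegral.integral_of_le hR]
  have hprod : Integrable (Function.uncurry fun (r : ℝ) (x : Plane) =>
      Q (r⁻¹ • x) / r * lap ψ x) ((volume.restrict (Set.Ioc 0 R)).prod volume) := by
    refine ((h.integrable_prod R).norm.mul_const M).mono' ?_ (ae_of_all _ fun q => ?_)
    · exact (h.integrable_prod R).aestronglyMeasurable.mul
        (hψ.laplacian_infty.continuous.comp continuous_snd).aestronglyMeasurable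
    · simp only [Function.uncurry]
      rw [norm_mul]
      exact mul_le_mul_of_nonneg_left (hM _) (norm_nonneg _)
  have e1 : ∫ x, potential Q R x * lap ψ x =
      ∫ x, ∫ r in Set.Ioc 0 R, Q (r⁻¹ • x) / r * lap ψ x := by
    simp only [potential, integral_mul_const]
  rw [e1, ← integral_integral_swap hprod]
  refine setIntegral_congr_fun measurableSet_Ioc fun r hr => ?_
  have hr0 : r ≠ 0 := hr.1.ne'
  have e2 := Measure.integral_comp_inv_smul_of_nonneg (volume : Measure Plane)
    (fun z => Q z / r * lap ψ (r • z)) hr.1.le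
  simp only [smul_inv_smul₀ hr0] at e2
  change ∫ x, Q (r⁻¹ • x) / r * lap ψ x = r * ∫ z, Q z * lap ψ (r • z)
  rw [e2, ← integral_const_mul]
  rw [smul_eq_mul, ← integral_const_mul]
  refine integral_congr_ae (ae_of_all _ fun z => ?_)
  simp
  field_simp

end KernelPair

/-! ### The kernel of the disc and a smooth kernel -/

theorem hasFDerivAt_one_sub_norm_sq (z : Plane) :
    HasFDerivAt (fun z : Plane => 1 - ‖z‖ ^ 2) (-(2 • innerSL ℝ z)) z := by
  simpa using (hasStrictFDerivAt_norm_sq z).hasFDerivAt.const_sub 1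

theorem innerSL_single (z : Plane) (i : Fin 2) :
    innerSL ℝ z (EuclideanSpace.single i 1) = z i := by
  simp [EuclideanSpace.inner_single_right]

/-- Inside the disc $\nabla(1-|z|^2)=-2z$, which matches the density $1/\pi$; outside both sides
vanish. The kink on the unit circle is a null set. -/
theorem kernelPair_ball : KernelPair (fun z => max (1 - ‖z‖ ^ 2) 0 / (2 * Real.pi))
    ((Metric.ball 0 1).indicator fun _ => 1 / Real.pi) where
  lipschitz := by
    have h1 : ∀ a b : ℝ, 0 ≤ a → 0 ≤ b → a ≤ b →
        |max (1 - a ^ 2) 0 - max (1 - b ^ 2) 0| ≤ 2 * |a - b| := by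
      intro a b ha hb hab
      rw [abs_sub_comm a b, abs_of_nonneg (sub_nonneg.2 hab)]
      have hle : max (1 - b ^ 2) 0 ≤ max (1 - a ^ 2) 0 :=
        max_le_max (by nlinarith) le_rfl
      rw [abs_of_nonneg (sub_nonneg.2 hle)]
      rcases le_total 1 a with h | h
      · rw [max_eq_right (show 1 - a ^ 2 ≤ 0 by nlinarith)]
        linarith [le_max_right (1 - b ^ 2) 0]
      · rw [max_eq_left (show 0 ≤ 1 - a ^ 2 by nlinarith)]
        rcases le_total 1 b with h' | h'
        · nlinarith [le_max_right (1 - b ^ 2) 0]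
        · nlinarith [le_max_left (1 - b ^ 2) 0]
    have h2 : LipschitzWith 2 fun z : Plane => max (1 - ‖z‖ ^ 2) 0 := by
      refine LipschitzWith.of_dist_le_mul fun x y => ?_
      have h3 : |max (1 - ‖x‖ ^ 2) 0 - max (1 - ‖y‖ ^ 2) 0| ≤ 2 * |‖x‖ - ‖y‖| := by
        rcases le_total ‖x‖ ‖y‖ with h | h
        · exact h1 _ _ (norm_nonneg _) (norm_nonneg _) h
        · rw [abs_sub_comm, abs_sub_comm ‖x‖]
          exact h1 _ _ (norm_nonneg _) (norm_nonneg _) h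
      rw [Real.dist_eq, dist_eq_norm]
      exact h3.trans (mul_le_mul_of_nonneg_left (abs_norm_sub_norm_le x y) (by norm_num))
    refine ⟨‖(2 * Real.pi)⁻¹‖₊ * 2, ?_⟩
    have h3 : LipschitzWith ‖(2 * Real.pi)⁻¹‖₊ fun t : ℝ => t / (2 * Real.pi) := by
      simpa [div_eq_inv_mul] using lipschitzWith_smul (β := ℝ) ((2 * Real.pi)⁻¹)
    exact h3.comp h2
  eq_zero z hz := by
    rw [max_eq_right (by nlinarith), zero_div]
  integrable := by
    refine IntegrableOn.integrable_indicator ?_ Metric.isOpen_ball.measurableSet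
    exact integrableOn_const measure_ball_lt_top.ne
  density_eq_zero z hz := by
    refine Set.indicator_of_notMem (fun h => ?_) _
    rw [mem_ball_zero_iff] at h
    exact absurd h hz.not_gt
  lineDeriv_eq i := by
    have : ∀ᵐ z : Plane, z ∉ Metric.sphere (0 : Plane) 1 :=
      measure_eq_zero_iff_ae_notMem.1 (Measure.addHaar_sphere volume (0 : Plane) 1)
    filter_upwards [this] with z hz
    rw [mem_sphere_zero_iff_norm] at hz
    rcases lt_or_gt_of_ne hz with h | h
    · have he : (fun z : Plane => max (1 - ‖z‖ ^ 2) 0 / (2 * Real.pi)) =ᶠ[𝓝 z]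
          fun z => (1 - ‖z‖ ^ 2) * (2 * Real.pi)⁻¹ := by
        filter_upwards [continuous_norm.continuousAt.eventually_lt continuousAt_const h] with y hy
        rw [max_eq_left (by nlinarith [norm_nonneg y]), div_eq_mul_inv]
      have hd := ((hasFDerivAt_one_sub_norm_sq z).mul_const
        (2 * Real.pi)⁻¹).congr_of_eventuallyEq he
      rw [hd.differentiableAt.lineDeriv_eq_fderiv, hd.fderiv, Set.indicator_of_mem (by simpa)]
      have := innerSL_single z i
      simp only [smul_apply, neg_apply, this]
      have := Real.pi_ne_zero
      simp
      field_simp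
    · have he : (fun z : Plane => max (1 - ‖z‖ ^ 2) 0 / (2 * Real.pi)) =ᶠ[𝓝 z]
          fun _ => (0 : ℝ) := by
        filter_upwards [continuousAt_const.eventually_lt continuous_norm.continuousAt h] with y hy
        rw [max_eq_right (by nlinarith [norm_nonneg y]), zero_div]
      have hd := (hasFDerivAt_const (𝕜 := ℝ) (0 : ℝ) z).congr_of_eventuallyEq he
      rw [hd.differentiableAt.lineDeriv_eq_fderiv, hd.fderiv,
        Set.indicator_of_notMem (by simpa using h.le)]
      simp
  integral_eq_one := by
    rw [integral_indicator Metric.isOpen_ball.measurableSet, setIntegral_const, Measure.real,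
      EuclideanSpace.volume_ball_fin_two]
    simp [Real.pi_pos.le, Real.pi_ne_zero]

/-- For a profile $G$ vanishing on $(-\infty,0]$, the pair $G(1-|z|^2)$, $2G'(1-|z|^2)$ satisfies
the gradient relation. Taking $G$ smooth and normalising the mass gives the smooth density needed to
regularise in Weyl's lemma. -/
theorem exists_smooth_kernelPair : ∃ Q B : Plane → ℝ, KernelPair Q B ∧ ContDiff ℝ ∞ B ∧
    HasCompactSupport B := by
  have hG : ContDiff ℝ ∞ expNegInvGlue := expNegInvGlue.contDiff
  have hG' : ContDiff ℝ ∞ (deriv expNegInvGlue) := (contDiff_infty_iff_deriv.1 hG).2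
  set B₀ : Plane → ℝ := fun z => 2 * deriv expNegInvGlue (1 - ‖z‖ ^ 2) with hB₀
  have hn : ContDiff ℝ ∞ fun z : Plane => 1 - ‖z‖ ^ 2 :=
    contDiff_const.sub (contDiff_norm_sq ℝ (E := Plane))
  have hB : ContDiff ℝ ∞ B₀ := contDiff_const.mul (hG'.comp hn)
  have hz0 : ∀ z : Plane, 1 < ‖z‖ → B₀ z = 0 := by
    intro z hz
    have he : expNegInvGlue =ᶠ[𝓝 (1 - ‖z‖ ^ 2)] fun _ => 0 := by
      filter_upwards [gt_mem_nhds (show 1 - ‖z‖ ^ 2 < 0 by nlinarith)] with y hy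
      exact expNegInvGlue.zero_of_nonpos (le_of_lt hy)
    simp [hB₀, he.deriv_eq]
  have hBc : HasCompactSupport B₀ := HasCompactSupport.intro (isCompact_closedBall (0 : Plane) 1)
    fun z hz => hz0 z (by simpa using hz)
  have hpos : 0 < ∫ z, B₀ z := by
    -- The glue function goes from $0$ to a positive value on $[0,1]$, so its derivative is positive
    -- at some $s$; a point with $|z|^2=1-s$ then shows that the density is not identically zero.
    obtain ⟨s, hs, hs'⟩ := exists_deriv_eq_slope expNegInvGlue zero_lt_one
      hG.continuous.continuousOn (hG.differentiable (by simp)).differentiableOn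
    have hs1 : 0 < deriv expNegInvGlue s := by
      rw [hs', expNegInvGlue.zero]
      simpa using expNegInvGlue.pos_of_pos one_pos
    refine hB.continuous.integral_pos_of_hasCompactSupport_nonneg_nonzero hBc
      (fun z => mul_nonneg zero_le_two expNegInvGlue.monotone.deriv_nonneg)
      (x := EuclideanSpace.single 0 (Real.sqrt (1 - s))) ?_
    have : 1 - ‖(EuclideanSpace.single 0 (Real.sqrt (1 - s)) : Plane)‖ ^ 2 = s := by
      rw [PiLp.norm_single, Real.norm_eq_abs, sq_abs, Real.sq_sqrt (by linarith [hs.2])]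
      ring
    simp only [hB₀, this]
    positivity
  set c : ℝ := (∫ z, B₀ z)⁻¹ with hc
  refine ⟨fun z => c * expNegInvGlue (1 - ‖z‖ ^ 2), fun z => c * B₀ z, ?_, contDiff_const.mul hB,
    hBc.mul_left⟩
  have hQ : ContDiff ℝ ∞ fun z : Plane => c * expNegInvGlue (1 - ‖z‖ ^ 2) :=
    contDiff_const.mul (hG.comp hn)
  have hQ0 : ∀ z : Plane, 1 ≤ ‖z‖ → c * expNegInvGlue (1 - ‖z‖ ^ 2) = 0 := fun z hz => by
    rw [expNegInvGlue.zero_of_nonpos (by nlinarith), mul_zero]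
  have hQc : HasCompactSupport fun z : Plane => c * expNegInvGlue (1 - ‖z‖ ^ 2) :=
    HasCompactSupport.intro (isCompact_closedBall (0 : Plane) 1) fun z hz =>
      hQ0 z (by simp at hz; exact hz.le)
  exact
  { lipschitz := ContDiff.lipschitzWith_of_hasCompactSupport hQc hQ (by simp)
    eq_zero := hQ0
    integrable := (hB.continuous.integrable_of_hasCompactSupport hBc).const_mul c
    density_eq_zero := fun z hz => by rw [hz0 z hz, mul_zero]
    lineDeriv_eq := fun i => ae_of_all _ fun z => by
      have hd : HasFDerivAt (fun z : Plane => c * expNegInvGlue (1 - ‖z‖ ^ 2)) _ z :=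
        (((hG.differentiable (by simp) _).hasDerivAt.comp_hasFDerivAt z
          (hasFDerivAt_one_sub_norm_sq z)).const_mul c)
      rw [hd.differentiableAt.lineDeriv_eq_fderiv, hd.fderiv]
      have := innerSL_single z i
      simp only [smul_apply, neg_apply, this, hB₀]
      simp
      ring
    integral_eq_one := by
      rw [integral_const_mul]
      exact inv_mul_cancel₀ hpos.ne' }

/-! ### Weyl's lemma -/

theorem pd_comp_sub_left (f : Plane → ℝ) (a : Plane) (i : Fin 2) :
    pd i (fun t => f (a - t)) = fun t => -pd i f (a - t) := by
  ext t
  have e := (ContinuousLinearEquiv.neg ℝ (M := Plane)).comp_right_fderiv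
    (f := fun s => f (a + s)) (x := t)
  have e' : (fun s => f (a + s)) ∘ (ContinuousLinearEquiv.neg ℝ (M := Plane)) =
      fun t => f (a - t) := by
    ext s
    simp [sub_eq_add_neg]
  rw [e'] at e
  rw [pd, e, fderiv_comp_add_left]
  simp [pd, sub_eq_add_neg]

theorem pd_neg (f : Plane → ℝ) (i : Fin 2) : pd i (fun t => -f t) = fun t => -pd i f t := by
  ext t
  simp [pd, fderiv_fun_neg]

theorem lap_comp_sub_left (f : Plane → ℝ) (a t : Plane) :
    lap (fun t => f (a - t)) t = lap f (a - t) := by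
  refine Finset.sum_congr rfl fun i _ => ?_
  simp only [pd_comp_sub_left, pd_neg, neg_neg]

section Convolution

open scoped Convolution

theorem pd_convolution {k f : Plane → ℝ} (hk : LocallyIntegrable k) (hf : ContDiff ℝ 1 f)
    (hc : HasCompactSupport f) (i : Fin 2) :
    pd i (k ⋆[ContinuousLinearMap.mul ℝ ℝ] f) = k ⋆[ContinuousLinearMap.mul ℝ ℝ] (pd i f) := by
  ext x
  rw [pd, (hc.hasFDerivAt_convolution_right (ContinuousLinearMap.mul ℝ ℝ) hk hf x).fderiv,
    convolution_precompR_apply _ hk (hc.fderiv ℝ) (hf.continuous_fderiv (by simp))]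
  rfl

theorem lap_convolution {k f : Plane → ℝ} (hk : LocallyIntegrable k) (hf : ContDiff ℝ ∞ f)
    (hc : HasCompactSupport f) (x : Plane) :
    lap (k ⋆[ContinuousLinearMap.mul ℝ ℝ] f) x = ∫ t, k t * lap f (x - t) := by
  simp only [lap, Finset.mul_sum]
  rw [integral_finsetSum]
  · refine Finset.sum_congr rfl fun i _ => ?_
    rw [pd_convolution hk (hf.of_le (by simp)) hc,
      pd_convolution hk ((hf.pderiv_infty i).of_le (by simp)) (hc.pderiv i)]
    rfl
  · intro i _
    exact ((hc.pderiv i).pderiv i).convolutionExists_right (ContinuousLinearMap.mul ℝ ℝ) hk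
      ((hf.pderiv_infty i).pderiv_infty i).continuous x

/-- `v` is harmonic in `U` in the sense of distributions. -/
def WeaklyHarmonic (U : Set Plane) (v : Plane → ℝ) : Prop :=
  ∀ ψ : Plane → ℝ, ContDiff ℝ ∞ ψ → HasCompactSupport ψ → tsupport ψ ⊆ U →
    ∫ x, v x * lap ψ x = 0

/-- The smooth-kernel potential $k$ of radius $\rho$ is a parametrix: $\Delta(k*\psi)$ is a smooth
average of $\psi$ minus $\psi$. Testing $v$ against $k*\psi$ therefore gives $\int
v\psi=\int\psi\,(v*g)$, so $v$ agrees near $a$ with the smooth function $v*g$. -/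
theorem WeaklyHarmonic.exists_local_smooth {U : Set Plane} {v : Plane → ℝ} (hv : Integrable v)
    (h : WeaklyHarmonic U v) {a : Plane} {ρ : ℝ} (hρ : 0 < ρ)
    (hU : Metric.closedBall a (2 * ρ) ⊆ U) :
    ∃ F : Plane → ℝ, ContDiff ℝ ∞ F ∧ ∀ᵐ x, x ∈ Metric.ball a ρ → F x = v x := by
  obtain ⟨Q, B, hQB, hB, hBc⟩ := exists_smooth_kernelPair
  set k := KernelPair.potential Q ρ with hk
  have hki : Integrable k := hQB.integrable_potential ρ
  have hkc : HasCompactSupport k := HasCompactSupport.intro (isCompact_closedBall (0 : Plane) ρ)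
    fun z hz => hQB.potential_eq_zero (by simp at hz; exact hz.le)
  -- The rescaled density is reflected because Fubini passes the averaging from $\psi$ to $v$.
  set g : Plane → ℝ := fun s => (ρ ^ 2)⁻¹ * B (-(ρ⁻¹ • s)) with hg
  have hgs : ContDiff ℝ ∞ g := contDiff_const.mul (hB.comp (contDiff_id.const_smul _).neg)
  have hgc : HasCompactSupport g := by
    have := (hBc.comp_smul (c := -ρ⁻¹) (by simpa using hρ.ne')).mul_left (f := fun _ => (ρ ^ 2)⁻¹)
    simp only [neg_smul] at this
    exact this
  obtain ⟨N, hN0, hN⟩ := exists_bound_of_compactSupport hgs.continuous hgc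
  set F := v ⋆[ContinuousLinearMap.mul ℝ ℝ] g with hF
  have hFs : ContDiff ℝ ∞ F := hgc.contDiff_convolution_right _ hv.locallyIntegrable hgs
  refine ⟨F, hFs, ?_⟩
  have hmain : ∀ᵐ x, x ∈ Metric.ball a ρ → F x - v x = 0 := by
    refine Metric.isOpen_ball.ae_eq_zero_of_integral_contDiff_smul_eq_zero
      ((hFs.continuous.locallyIntegrable.sub hv.locallyIntegrable).locallyIntegrableOn _)
      fun ψ hψ hψc hψU => ?_
    obtain ⟨M, hM0, hM⟩ := exists_bound_of_compactSupport hψ.continuous hψc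
    have hi : Integrable ψ := hψ.continuous.integrable_of_hasCompactSupport hψc
    have hvψ : Integrable fun x => v x * ψ x :=
      hv.mul_bdd (c := M) hψ.continuous.aestronglyMeasurable (ae_of_all _ hM)
    set Ψ := k ⋆[ContinuousLinearMap.mul ℝ ℝ] ψ with hΨ
    have hΨs : ContDiff ℝ ∞ Ψ := hψc.contDiff_convolution_right _ hki.locallyIntegrable hψ
    -- The parametrix and $\psi$ each contribute a radius $\rho$; this is the reason for the doubled
    -- ball in the hypothesis.
    have hΨt : tsupport Ψ ⊆ Metric.closedBall a (2 * ρ) := by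
      refine closure_minimal (fun x hx => ?_) Metric.isClosed_closedBall
      obtain ⟨s, hs, t, ht, rfl⟩ := support_convolution_subset _ hx
      have hs' : ‖s‖ < ρ := by
        by_contra hc
        exact hs (hQB.potential_eq_zero (not_lt.1 hc))
      have ht' := hψU (subset_tsupport _ ht)
      rw [mem_ball_iff_norm] at ht'
      rw [mem_closedBall_iff_norm, show s + t - a = s + (t - a) by abel]
      exact (norm_add_le _ _).trans (by linarith)
    have hΨc : HasCompactSupport Ψ := hkc.convolution _ hψc
    have h0 := h Ψ hΨs hΨc (hΨt.trans hU)
    have hlap : ∀ x, lap Ψ x = (∫ y, g (y - x) * ψ y) - ψ x := by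
      intro x
      rw [hΨ, lap_convolution hki.locallyIntegrable hψ hψc]
      have hs : ContDiff ℝ ∞ fun t => ψ (x - t) := hψ.comp (contDiff_const.sub contDiff_id)
      have hsc : HasCompactSupport fun t => ψ (x - t) :=
        hψc.comp_homeomorph (Homeomorph.subLeft x)
      have e := hQB.integral_potential_mul_lap hs hsc hρ.le
      simp only [lap_comp_sub_left, sub_zero] at e
      rw [e]
      congr 1
      have e2 := Measure.integral_comp_inv_smul_of_nonneg (volume : Measure Plane)
        (fun z => B z * ψ (x - ρ • z)) hρ.le
      simp only [smul_inv_smul₀ hρ.ne'] at e2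
      have e3 : ∫ z, B z * ψ (x - ρ • z) = (ρ ^ 2)⁻¹ * ∫ z, B (ρ⁻¹ • z) * ψ (x - z) := by
        rw [e2]
        have := hρ.ne'
        simp
        field_simp
      rw [e3, ← integral_const_mul, ← integral_sub_left_eq_self _ volume x]
      refine integral_congr_ae (ae_of_all _ fun y => ?_)
      simp only [hg, ← smul_neg, neg_sub, sub_sub_cancel]
      ring
    have hprod : Integrable (Function.uncurry fun x y => v x * (g (y - x) * ψ y))
        ((volume : Measure Plane).prod volume) := by
      refine ((hv.mul_prod hi).norm.mul_const N).mono' ?_ (ae_of_all _ fun q => ?_)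
      · exact hv.aestronglyMeasurable.comp_fst.mul ((hgs.continuous.comp
          (continuous_snd.sub continuous_fst)).mul
          (hψ.continuous.comp continuous_snd)).aestronglyMeasurable
      · simp only [Function.uncurry, norm_mul]
        have := mul_le_mul_of_nonneg_left (hN (q.2 - q.1))
          (mul_nonneg (norm_nonneg (v q.1)) (norm_nonneg (ψ q.2)))
        simp only [Real.norm_eq_abs] at this ⊢
        linarith
    have hswap : ∫ x, v x * ∫ y, g (y - x) * ψ y = ∫ y, ψ y * F y := by
      simp only [← integral_const_mul]
      rw [integral_integral_swap hprod]
      refine integral_congr_ae (ae_of_all _ fun y => ?_)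
      simp only [hF, convolution_def, ContinuousLinearMap.mul_apply', ← integral_const_mul]
      exact integral_congr_ae (ae_of_all _ fun x => by ring)
    have hint1 : Integrable fun x => v x * ∫ y, g (y - x) * ψ y := by
      have := hprod.integral_prod_left
      simpa only [Function.uncurry, integral_const_mul] using this
    simp only [hlap, mul_sub] at h0
    rw [integral_sub hint1 hvψ, hswap] at h0
    have hF1 : Integrable fun x => ψ x * F x :=
      (hψ.continuous.mul hFs.continuous).integrable_of_hasCompactSupport hψc.mul_right
    simp only [smul_eq_mul, mul_sub]
    rw [integral_sub hF1 (by simpa only [mul_comm] using hvψ), ← h0]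
    simp only [mul_comm]
  filter_upwards [hmain] with x hx hxb
  linarith [hx hxb]

end Convolution

/-- **Weyl's lemma**. -/
theorem WeaklyHarmonic.exists_harmonic {U : Set Plane} (hUo : IsOpen U) {v : Plane → ℝ}
    (hv : Integrable v) (h : WeaklyHarmonic U v) :
    ∃ F : Plane → ℝ, (∀ x ∈ U, ContDiffAt ℝ ∞ F x) ∧ (∀ᵐ x, x ∈ U → F x = v x) ∧
      ∀ x ∈ U, lap F x = 0 := by
  have hloc : ∀ a ∈ U, ∃ ρ > 0, ∃ F : Plane → ℝ, ContDiff ℝ ∞ F ∧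
      ∀ᵐ x, x ∈ Metric.ball a ρ → F x = v x := by
    intro a ha
    obtain ⟨r, hr, hrU⟩ := Metric.nhds_basis_closedBall.mem_iff.1 (hUo.mem_nhds ha)
    obtain ⟨F, hF⟩ := h.exists_local_smooth hv (a := a) (ρ := r / 2) (by linarith)
      (by rwa [mul_div_cancel₀ _ two_ne_zero])
    exact ⟨r / 2, by linarith, F, hF⟩
  choose! ρ hρ F hFs hF using hloc
  -- Gluing along the diagonal: two local smooth versions agree almost everywhere, hence everywhere,
  -- on the overlap of their balls. So $x\mapsto F_x(x)$ coincides with $F_a$ near $a$.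
  have hloc : ∀ a ∈ U, ∀ x ∈ U ∩ Metric.ball a (ρ a), F x x = F a x := by
    intro a ha x hx
    have hO : IsOpen (Metric.ball a (ρ a) ∩ Metric.ball x (ρ x)) :=
      Metric.isOpen_ball.inter Metric.isOpen_ball
    refine Measure.eqOn_open_of_ae_eq (μ := volume) (f := F x) (g := F a) ?_ hO
      (hFs x hx.1).continuous.continuousOn (hFs a ha).continuous.continuousOn
      ⟨hx.2, Metric.mem_ball_self (hρ x hx.1)⟩
    refine (ae_restrict_iff' hO.measurableSet).2 ?_
    filter_upwards [hF a ha, hF x hx.1] with y h1 h2 hy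
    rw [h1 hy.1, h2 hy.2]
  have hnear : ∀ a ∈ U, (fun x => F x x) =ᶠ[𝓝 a] F a := by
    intro a ha
    filter_upwards [hUo.mem_nhds ha, Metric.ball_mem_nhds a (hρ a ha)] with x h1 h2
    exact hloc a ha x ⟨h1, h2⟩
  have hsm : ∀ x ∈ U, ContDiffAt ℝ ∞ (fun x => F x x) x := fun x hx =>
    (hFs x hx).contDiffAt.congr_of_eventuallyEq (hnear x hx)
  have hae : ∀ᵐ x, x ∈ U → F x x = v x := by
    have : volume {x | x ∈ U ∧ F x x ≠ v x} = 0 := by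
      refine measure_null_of_locally_null _ fun a ha => ?_
      refine ⟨{x | x ∈ U ∧ F x x ≠ v x} ∩ Metric.ball a (ρ a), inter_mem_nhdsWithin _
        (Metric.ball_mem_nhds a (hρ a ha.1)), ?_⟩
      refine measure_mono_null ?_ (ae_iff.1 (hF a ha.1))
      rintro x ⟨⟨h1, h2⟩, h3⟩ h4
      exact h2 ((hloc a ha.1 x ⟨h1, h3⟩).trans (h4 h3))
    rw [ae_iff]
    simpa only [Classical.not_imp] using this
  refine ⟨fun x => F x x, hsm, hae, ?_⟩
  have hlc : ContinuousOn (lap fun x => F x x) U := fun x hx =>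
    ((hsm x hx).of_le (by norm_cast)).continuousAt_lap.continuousWithinAt
  -- With smoothness known, Green's identity moves the Laplacian back from the test function.
  have hz : ∀ᵐ x, x ∈ U → lap (fun x => F x x) x = 0 := by
    refine hUo.ae_eq_zero_of_integral_contDiff_smul_eq_zero
      (hlc.locallyIntegrableOn hUo.measurableSet) fun ψ hψ hψc hψU => ?_
    have e := integral_mul_lap_comm (hψ.of_le (by norm_cast)) hψc
      (f := fun x => F x x) fun x hx => (hsm x (hψU hx)).of_le (by norm_cast)
    simp only [smul_eq_mul, mul_comm (ψ _)]
    rw [← e, ← h ψ hψ hψc hψU]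
    refine integral_congr_ae ?_
    filter_upwards [hae] with x hx
    by_cases hxU : x ∈ U
    · rw [hx hxU]
    · rw [lap_eq_zero_of_notMem fun h => hxU (hψU h), mul_zero, mul_zero]
  exact Measure.eqOn_open_of_ae_eq (g := fun _ => (0 : ℝ))
    ((ae_restrict_iff' hUo.measurableSet).2 hz) hUo hlc continuousOn_const

/-! ### Convex truncations and boundary layers -/

/-- A smooth convex function vanishing on `(-∞, 0]`, with slope one on `[1, ∞)`. -/
noncomputable def ramp (x : ℝ) : ℝ := ∫ s in (0 : ℝ)..x, Real.smoothTransition s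

theorem hasDerivAt_ramp (x : ℝ) : HasDerivAt ramp (Real.smoothTransition x) x :=
  intervalIntegral.integral_hasDerivAt_right
    (Real.smoothTransition.continuous.intervalIntegrable _ _)
    (Real.smoothTransition.continuous.stronglyMeasurableAtFilter _ _)
    Real.smoothTransition.continuous.continuousAt

theorem deriv_ramp : deriv ramp = Real.smoothTransition := funext fun x => (hasDerivAt_ramp x).deriv

theorem contDiff_ramp : ContDiff ℝ ∞ ramp :=
  contDiff_infty_iff_deriv.2 ⟨fun x => (hasDerivAt_ramp x).differentiableAt, by
    rw [deriv_ramp]; exact Real.smoothTransition.contDiff⟩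

theorem monotone_ramp : Monotone ramp :=
  monotone_of_deriv_nonneg (contDiff_ramp.differentiable (by simp)) fun x => by
    rw [deriv_ramp]; exact Real.smoothTransition.nonneg x

theorem ramp_of_nonpos {x : ℝ} (hx : x ≤ 0) : ramp x = 0 := by
  rw [ramp, intervalIntegral.integral_congr (g := fun _ => (0 : ℝ))]
  · simp
  · intro s hs
    rw [Set.uIcc_of_ge hx] at hs
    exact Real.smoothTransition.zero_of_nonpos hs.2

theorem ramp_nonneg (x : ℝ) : 0 ≤ ramp x := by
  rcases le_total x 0 with h | h
  · exact (ramp_of_nonpos h).ge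
  · exact (ramp_of_nonpos le_rfl).symm.le.trans (monotone_ramp h)

theorem ramp_le {x : ℝ} (hx : 0 ≤ x) : ramp x ≤ x := by
  have := intervalIntegral.integral_mono_on hx
    (Real.smoothTransition.continuous.intervalIntegrable (μ := volume) 0 x)
    ((continuous_const (y := (1 : ℝ))).intervalIntegrable 0 x)
    fun s _ => Real.smoothTransition.le_one s
  simpa [ramp] using this

theorem ramp_le_of_le {x y : ℝ} (hxy : x ≤ y) (hy : 0 ≤ y) : ramp x ≤ y :=
  (monotone_ramp hxy).trans (ramp_le hy)

theorem ramp_pos {x : ℝ} (hx : 0 < x) : 0 < ramp x :=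
  intervalIntegral.intervalIntegral_pos_of_pos_on
    (Real.smoothTransition.continuous.intervalIntegrable _ _)
    (fun _ hs => Real.smoothTransition.pos_of_pos hs.1) hx

theorem deriv_smoothTransition_nonneg (x : ℝ) : 0 ≤ deriv Real.smoothTransition x :=
  Real.smoothTransition.monotone.deriv_nonneg

theorem deriv_smoothTransition_of_neg {x : ℝ} (hx : x < 0) : deriv Real.smoothTransition x = 0 := by
  have : Real.smoothTransition =ᶠ[𝓝 x] fun _ => 0 := by
    filter_upwards [gt_mem_nhds hx] with y hy
    exact Real.smoothTransition.zero_of_nonpos (le_of_lt hy)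
  simp [this.deriv_eq]

theorem deriv_smoothTransition_of_one_lt {x : ℝ} (hx : 1 < x) :
    deriv Real.smoothTransition x = 0 := by
  have : Real.smoothTransition =ᶠ[𝓝 x] fun _ => 1 := by
    filter_upwards [lt_mem_nhds hx] with y hy
    exact Real.smoothTransition.one_of_one_le (le_of_lt hy)
  simp [this.deriv_eq]

theorem continuous_deriv_smoothTransition : Continuous (deriv Real.smoothTransition) :=
  (Real.smoothTransition.contDiff (n := 1)).continuous_deriv le_rfl

/-- The rescaled ramp, vanishing on `(-∞, t]`, with slope one on `[2t, ∞)`. -/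
noncomputable def rampAt (t s : ℝ) : ℝ := t * ramp (s / t - 1)

theorem deriv_rampAt {t : ℝ} (ht : 0 < t) :
    deriv (rampAt t) = fun s => Real.smoothTransition (s / t - 1) := by
  ext s
  have h1 : HasDerivAt (fun s : ℝ => s / t - 1) (1 / t) s :=
    ((hasDerivAt_id s).div_const t).sub_const 1
  have := (((hasDerivAt_ramp (s / t - 1)).comp s h1).const_mul t).deriv
  rw [show rampAt t = fun s => t * (ramp ∘ fun s => s / t - 1) s from rfl, this]
  field_simp

theorem deriv_deriv_rampAt {t : ℝ} (ht : 0 < t) :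
    deriv (deriv (rampAt t)) = fun s => deriv Real.smoothTransition (s / t - 1) / t := by
  rw [deriv_rampAt ht]
  ext s
  have h1 : HasDerivAt (fun s : ℝ => s / t - 1) (1 / t) s :=
    ((hasDerivAt_id s).div_const t).sub_const 1
  have h2 := ((Real.smoothTransition.contDiff (n := 1)).differentiable (by simp)
    (s / t - 1)).hasDerivAt
  have := (h2.comp s h1).deriv
  rw [show (fun s => Real.smoothTransition (s / t - 1)) =
    Real.smoothTransition ∘ fun s => s / t - 1 from rfl, this]
  ring

theorem contDiff_rampAt (t : ℝ) : ContDiff ℝ ∞ (rampAt t) :=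
  contDiff_const.mul (contDiff_ramp.comp ((contDiff_id.div_const t).sub contDiff_const))

theorem rampAt_of_le {t s : ℝ} (ht : 0 < t) (hs : s ≤ t) : rampAt t s = 0 := by
  rw [rampAt, ramp_of_nonpos, mul_zero]
  rw [sub_nonpos]
  exact (div_le_one ht).2 hs

theorem rampAt_nonneg {t : ℝ} (ht : 0 < t) (s : ℝ) : 0 ≤ rampAt t s :=
  mul_nonneg ht.le (ramp_nonneg _)

/-- The weight `H_t''(φ) |∇φ|²`, concentrated on the layer `{t ≤ φ ≤ 2t}`. -/
noncomputable def layerWeight (φ : Plane → ℝ) (t : ℝ) (x : Plane) : ℝ :=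
  deriv Real.smoothTransition (φ x / t - 1) / t * ∑ i, pd i φ x ^ 2

theorem layerWeight_nonneg (φ : Plane → ℝ) {t : ℝ} (ht : 0 < t) (x : Plane) :
    0 ≤ layerWeight φ t x :=
  mul_nonneg (div_nonneg (deriv_smoothTransition_nonneg _) ht.le)
    (Finset.sum_nonneg fun _ _ => sq_nonneg _)

theorem layerWeight_eq_zero {φ : Plane → ℝ} {t : ℝ} (ht : 0 < t) {x : Plane}
    (hx : 2 * t < φ x) : layerWeight φ t x = 0 := by
  rw [layerWeight, deriv_smoothTransition_of_one_lt, zero_div, zero_mul]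
  have : 2 < φ x / t := (lt_div_iff₀ ht).2 hx
  linarith

theorem continuous_layerWeight {φ : Plane → ℝ} (hφ : ContDiff ℝ ∞ φ) (t : ℝ) :
    Continuous (layerWeight φ t) :=
  ((continuous_deriv_smoothTransition.comp
    ((hφ.continuous.div_const t).sub continuous_const)).div_const t).mul
    (continuous_finsetSum _ fun i _ => (hφ.pderiv_infty i).continuous.pow 2)

/-- The truncation splits the Laplacian into a nonnegative term carried by the layer and a cut-off
copy of $\Delta\varphi$, which converges to $\Delta\varphi$ wherever $\varphi>0$ as $t\to0$. -/
theorem lap_rampAt_comp {φ : Plane → ℝ} (hφ : ContDiff ℝ ∞ φ) {t : ℝ} (ht : 0 < t) (x : Plane) :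
    lap (fun y => rampAt t (φ y)) x =
      layerWeight φ t x + Real.smoothTransition (φ x / t - 1) * lap φ x := by
  rw [lap_comp ((contDiff_rampAt t).of_le (by norm_cast)) (hφ.contDiffAt.of_le (by norm_cast)),
    deriv_deriv_rampAt ht, deriv_rampAt ht, layerWeight]

/-- Extension by zero: the two open sets $\Omega$ and $K^c$ cover the plane, and the extension is
regular on each. It makes truncations defined through the barrier available as compactly supported
functions in Green's identities. -/
theorem contDiff_indicator_of_eq_zero {Ω K : Set Plane} (hΩ : IsOpen Ω) (hK : IsCompact K)
    (hKΩ : K ⊆ Ω) {f : Plane → ℝ} {n : WithTop ℕ∞} (hf : ∀ x ∈ Ω, ContDiffAt ℝ n f x)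
    (h0 : ∀ x ∈ Ω, x ∉ K → f x = 0) :
    ContDiff ℝ n (Ω.indicator f) ∧ HasCompactSupport (Ω.indicator f) ∧
      tsupport (Ω.indicator f) ⊆ K := by
  have hz : ∀ x ∉ K, Ω.indicator f x = 0 := fun x hx => by
    by_cases hxΩ : x ∈ Ω
    · rw [Set.indicator_of_mem hxΩ, h0 x hxΩ hx]
    · exact Set.indicator_of_notMem hxΩ _
  refine ⟨contDiff_iff_contDiffAt.2 fun x => ?_, HasCompactSupport.intro hK hz,
    closure_minimal (fun x hx => by_contra fun h => hx (hz x h)) hK.isClosed⟩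
  by_cases hx : x ∈ K
  · refine (hf x (hKΩ hx)).congr_of_eventuallyEq ?_
    filter_upwards [hΩ.mem_nhds (hKΩ hx)] with y hy
    exact Set.indicator_of_mem hy _
  · refine (contDiffAt_const (c := (0 : ℝ))).congr_of_eventuallyEq ?_
    filter_upwards [hK.isClosed.isOpen_compl.mem_nhds hx] with y hy
    exact hz y hy

/-! ### Barriers, decay at the boundary, maximum principle -/

/-- A smooth function which is positive in `Ω`, vanishes on the boundary and is strictly
superharmonic near the boundary. -/
structure IsBarrier (Ω : Set Plane) (φ : Plane → ℝ) (c : ℝ) : Prop where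
  smooth : ContDiff ℝ ∞ φ
  pos : ∀ x ∈ Ω, 0 < φ x
  eq_zero : ∀ x ∈ frontier Ω, φ x = 0
  level_pos : 0 < c
  lap_neg : ∀ x ∈ Ω, φ x < c → lap φ x < 0

namespace IsBarrier

variable {Ω : Set Plane} {φ : Plane → ℝ} {c : ℝ}

theorem isCompact_superlevel (hφ : IsBarrier Ω φ c) (hb : Bornology.IsBounded Ω) (t : ℝ) :
    IsCompact (closure Ω ∩ {x | t ≤ φ x}) :=
  hb.isCompact_closure.inter_right (isClosed_le continuous_const hφ.smooth.continuous)

theorem superlevel_subset (hφ : IsBarrier Ω φ c) (ho : IsOpen Ω) {t : ℝ} (ht : 0 < t) :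
    closure Ω ∩ {x | t ≤ φ x} ⊆ Ω := by
  rintro x ⟨hx, hxt⟩
  by_contra h
  have : x ∈ frontier Ω := ⟨hx, by rwa [ho.interior_eq]⟩
  exact absurd (hφ.eq_zero x this ▸ hxt) (not_le.2 ht)

theorem exists_bound (hφ : IsBarrier Ω φ c) (hb : Bornology.IsBounded Ω) :
    ∃ M, 0 ≤ M ∧ ∀ x ∈ Ω, |lap φ x| ≤ M ∧ ∀ i, |pd i φ x| ≤ M := by
  obtain ⟨M, hM⟩ := hb.isCompact_closure.exists_bound_of_continuousOn
    hφ.smooth.laplacian_infty.continuous.continuousOn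
  have : ∀ i, ∃ M, ∀ x ∈ closure Ω, ‖pd i φ x‖ ≤ M := fun i =>
    hb.isCompact_closure.exists_bound_of_continuousOn
      (hφ.smooth.pderiv_infty i).continuous.continuousOn
  choose N hN using this
  refine ⟨max (max M 0) (max (N 0) (N 1)), (le_max_right _ _).trans (le_max_left _ _),
    fun x hx => ⟨(hM x (subset_closure hx)).trans
      ((le_max_left _ _).trans (le_max_left _ _)), fun i => ?_⟩⟩
  refine (hN i x (subset_closure hx)).trans (le_trans ?_ (le_max_right _ _))
  fin_cases i
  · exact le_max_left _ _
  · exact le_max_right _ _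

theorem exists_layerWeight_le (hφ : IsBarrier Ω φ c) (hb : Bornology.IsBounded Ω) (t : ℝ) :
    ∃ K, ∀ x ∈ Ω, |layerWeight φ t x| ≤ K := by
  obtain ⟨K, hK⟩ := hb.isCompact_closure.exists_bound_of_continuousOn
    (continuous_layerWeight hφ.smooth t).continuousOn
  exact ⟨K, fun x hx => hK x (subset_closure hx)⟩

theorem integrableOn_mul_layerWeight (hφ : IsBarrier Ω φ c) (ho : IsOpen Ω)
    (hb : Bornology.IsBounded Ω) {u : Plane → ℝ} (hu : IntegrableOn u Ω) (t : ℝ) :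
    IntegrableOn (fun x => u x * layerWeight φ t x) Ω := by
  obtain ⟨K, hK⟩ := hφ.exists_layerWeight_le hb t
  exact hu.mul_bdd (c := K) (continuous_layerWeight hφ.smooth t).aestronglyMeasurable
    ((ae_restrict_iff' ho.measurableSet).2 (ae_of_all _ hK))

/-- `u` vanishes on the boundary, in the sense that its mean over thin boundary layers is small
compared with their thickness. -/
def ZeroTrace (Ω : Set Plane) (φ : Plane → ℝ) (u : Plane → ℝ) : Prop :=
  Tendsto (fun t => ∫ x in Ω, |u x| * layerWeight φ t x) (𝓝[>] 0) (𝓝 0)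

/-- With $C$ large, the convex truncation $Z$ of $h-C\varphi$ is subharmonic in $\Omega$ and
supported near the boundary. Green's identity against the truncated barrier bounds $\int
Z(-\Delta\varphi)$, cut off near the boundary, by the layer integral of $|u|$. Letting $t\to0$ and
using $-\Delta\varphi>0$ forces $Z=0$ in the collar. -/
theorem le_mul_of_zeroTrace (hφ : IsBarrier Ω φ c) (ho : IsOpen Ω) (hb : Bornology.IsBounded Ω)
    {h u : Plane → ℝ} (hh : ∀ x ∈ Ω, ContDiffAt ℝ 2 h x)
    (hharm : ∀ x ∈ Ω, φ x < c → lap h x = 0) (hu : IntegrableOn u Ω) (htr : ZeroTrace Ω φ u)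
    (hae : ∀ᵐ x, x ∈ Ω → φ x < c → h x = u x) :
    ∃ C, 0 ≤ C ∧ ∀ x ∈ Ω, φ x < c → h x ≤ C * φ x := by
  have hc2 : 0 < c / 2 := half_pos hφ.level_pos
  obtain ⟨B, hB⟩ := (hφ.isCompact_superlevel hb (c / 2)).exists_bound_of_continuousOn
    (f := h) fun x hx => (hh x (hφ.superlevel_subset ho hc2 hx)).continuousAt.continuousWithinAt
  -- Chosen so that the bound already holds on $\{\varphi\ge c/2\}$, a compact subset of $\Omega$
  -- where $h\le B$.
  set C : ℝ := max B 0 / (c / 2) with hC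
  have hC0 : 0 ≤ C := div_nonneg (le_max_right _ _) hc2.le
  have hinner : ∀ x ∈ Ω, c / 2 ≤ φ x → h x ≤ C * φ x := by
    intro x hx hxc
    calc h x ≤ max B 0 := (le_abs_self _).trans ((hB x ⟨subset_closure hx, hxc⟩).trans
          (le_max_left _ _))
      _ = C * (c / 2) := by rw [hC, div_mul_cancel₀ _ hc2.ne']
      _ ≤ C * φ x := mul_le_mul_of_nonneg_left hxc hC0
  refine ⟨C, hC0, ?_⟩
  set m : Plane → ℝ := fun x => h x + (-C) * φ x with hm
  have hφ2 : ContDiff ℝ 2 φ := hφ.smooth.of_le (by norm_cast)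
  have hmc : ∀ x ∈ Ω, ContDiffAt ℝ 2 m x := fun x hx =>
    (hh x hx).add (contDiffAt_const.mul hφ2.contDiffAt)
  set Z : Plane → ℝ := fun x => ramp (m x) with hZ
  have hZc : ∀ x ∈ Ω, ContDiffAt ℝ 2 Z x := fun x hx =>
    (contDiff_ramp.of_le (by norm_cast)).contDiffAt.comp x (hmc x hx)
  have hZ0 : ∀ x, 0 ≤ Z x := fun x => ramp_nonneg _
  have hZin : ∀ x ∈ Ω, c / 2 ≤ φ x → Z x = 0 := fun x hx hxc =>
    ramp_of_nonpos (by simp only [hm]; linarith [hinner x hx hxc])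
  have hZle : ∀ᵐ x, x ∈ Ω → Z x ≤ |u x| := by
    filter_upwards [hae] with x hx hxΩ
    by_cases hxc : φ x < c
    · rw [← hx hxΩ hxc]
      refine ramp_le_of_le ?_ (abs_nonneg _)
      have := mul_nonneg hC0 (hφ.pos x hxΩ).le
      simp only [hm]
      linarith [le_abs_self (h x)]
    · rw [hZin x hxΩ (by linarith [not_lt.1 hxc])]
      exact abs_nonneg _
  -- Convexity handles the gradient term. The other term vanishes for $\varphi\ge c/2$, and for
  -- smaller $\varphi$ it has the sign of $-C\Delta\varphi$, since $h$ is harmonic there.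
  have hZlap : ∀ x ∈ Ω, 0 ≤ lap Z x := by
    intro x hx
    rw [hZ, lap_comp (contDiff_ramp.of_le (by norm_cast)) (hmc x hx), deriv_ramp]
    refine add_nonneg (mul_nonneg (deriv_smoothTransition_nonneg _)
      (Finset.sum_nonneg fun _ _ => sq_nonneg _)) ?_
    by_cases hxc : c / 2 ≤ φ x
    · rw [Real.smoothTransition.zero_of_nonpos, zero_mul]
      simp only [hm]
      linarith [hinner x hx hxc]
    · have hxc' : φ x < c := by linarith [not_le.1 hxc]
      refine mul_nonneg (Real.smoothTransition.nonneg _) ?_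
      rw [hm, lap_add (hh x hx) (contDiffAt_const.mul hφ2.contDiffAt),
        lap_const_mul _ hφ2.contDiffAt, hharm x hx hxc']
      have := mul_nonneg hC0 (neg_nonneg.2 (hφ.lap_neg x hx hxc').le)
      linarith
  have hΩm : MeasurableSet Ω := ho.measurableSet
  have hZi : IntegrableOn Z Ω := by
    refine Integrable.mono' hu.norm (ContinuousOn.aestronglyMeasurable (fun x hx =>
      (hZc x hx).continuousAt.continuousWithinAt) hΩm) ((ae_restrict_iff' hΩm).2 ?_)
    filter_upwards [hZle] with x hx hxΩ
    rw [Real.norm_of_nonneg (hZ0 x)]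
    exact hx hxΩ
  obtain ⟨M, hM0, hM⟩ := hφ.exists_bound hb
  have hsc : ∀ t, Continuous fun x => Real.smoothTransition (φ x / t - 1) := fun t =>
    Real.smoothTransition.continuous.comp ((hφ.smooth.continuous.div_const t).sub continuous_const)
  have hlc : Continuous (lap φ) := hφ.smooth.laplacian_infty.continuous
  have hZl : IntegrableOn (fun x => Z x * -lap φ x) Ω :=
    hZi.mul_bdd (c := M) hlc.neg.aestronglyMeasurable
      ((ae_restrict_iff' hΩm).2 (ae_of_all _ fun x hx => by
        rw [norm_neg]; exact (hM x hx).1))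
  have hs1 : ∀ s : ℝ, ‖Real.smoothTransition s‖ ≤ 1 := fun s => by
    rw [Real.norm_of_nonneg (Real.smoothTransition.nonneg _)]
    exact Real.smoothTransition.le_one _
  have hZs : ∀ t, IntegrableOn (fun x => Z x * -lap φ x * Real.smoothTransition (φ x / t - 1)) Ω :=
    fun t => hZl.mul_bdd (c := 1) (hsc t).aestronglyMeasurable (ae_of_all _ fun x => hs1 _)
  -- This is $0\le\int\Delta Z\,\psi=\int Z\,\Delta\psi$ with $\psi$ the truncated barrier, followed
  -- by $Z\le|u|$ in the layer.
  have hle : ∀ t > 0, ∫ x in Ω, Z x * -lap φ x * Real.smoothTransition (φ x / t - 1) ≤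
      ∫ x in Ω, |u x| * layerWeight φ t x := by
    intro t ht
    obtain ⟨hψ, hψc, hψs⟩ := contDiff_indicator_of_eq_zero ho (hφ.isCompact_superlevel hb t)
      (hφ.superlevel_subset ho ht) (f := fun x => rampAt t (φ x))
      (fun x _ => ((contDiff_rampAt t).comp hφ.smooth).contDiffAt)
      (fun x hx hxK => rampAt_of_le ht (by
        by_contra hlt
        exact hxK ⟨subset_closure hx, (not_le.1 hlt).le⟩))
    set ψ := Ω.indicator fun x => rampAt t (φ x) with hψdef
    have hψΩ := hψs.trans (hφ.superlevel_subset ho ht)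
    have e := integral_mul_lap_comm (hψ.of_le (by norm_cast)) hψc
      (fun x hx => hZc x (hψΩ hx))
    have hpos : 0 ≤ ∫ x, lap Z x * ψ x := integral_nonneg fun x => by
      by_cases hx : x ∈ Ω
      · refine mul_nonneg (hZlap x hx) ?_
        rw [hψdef, Set.indicator_of_mem hx]
        exact rampAt_nonneg ht _
      · rw [hψdef, Set.indicator_of_notMem hx, mul_zero]
        exact le_rfl
    rw [← e, ← setIntegral_eq_integral_of_forall_compl_eq_zero (s := Ω) fun x hx => by
      rw [lap_eq_zero_of_notMem fun h => hx (hψΩ h), mul_zero]] at hpos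
    have e2 : ∫ x in Ω, Z x * lap ψ x = ∫ x in Ω, (Z x * layerWeight φ t x -
        Z x * -lap φ x * Real.smoothTransition (φ x / t - 1)) := by
      refine setIntegral_congr_fun hΩm fun x hx => ?_
      have he : ψ =ᶠ[𝓝 x] fun x => rampAt t (φ x) := by
        filter_upwards [ho.mem_nhds hx] with y hy
        exact Set.indicator_of_mem hy _
      simp only [(Filter.EventuallyEq.laplacian he).eq_of_nhds, lap_rampAt_comp hφ.smooth ht]
      ring
    rw [e2, integral_sub (hφ.integrableOn_mul_layerWeight ho hb hZi t) (hZs t), sub_nonneg] at hpos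
    refine hpos.trans (setIntegral_mono_ae_restrict (hφ.integrableOn_mul_layerWeight ho hb hZi t)
      (hφ.integrableOn_mul_layerWeight ho hb hu.abs t) ((ae_restrict_iff' hΩm).2 ?_))
    filter_upwards [hZle] with x hx hxΩ
    exact mul_le_mul_of_nonneg_right (hx hxΩ) (layerWeight_nonneg φ ht x)
  have hlim : Tendsto (fun t => ∫ x in Ω, Z x * -lap φ x * Real.smoothTransition (φ x / t - 1))
      (𝓝[>] 0) (𝓝 (∫ x in Ω, Z x * -lap φ x)) := by
    refine tendsto_integral_filter_of_dominated_convergence (fun x => ‖Z x * -lap φ x‖)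
      (Eventually.of_forall fun t => (hZs t).aestronglyMeasurable)
      (Eventually.of_forall fun t => ae_of_all _ fun x => ?_) hZl.norm
      ((ae_restrict_iff' hΩm).2 (ae_of_all _ fun x hx => ?_))
    · rw [norm_mul]
      exact mul_le_of_le_one_right (norm_nonneg _) (hs1 _)
    · refine tendsto_const_nhds.congr' ?_
      have hp := hφ.pos x hx
      filter_upwards [Ioo_mem_nhdsGT (half_pos hp)] with t ht
      rw [Real.smoothTransition.one_of_one_le, mul_one]
      have : 2 ≤ φ x / t := (le_div_iff₀ ht.1).2 (by linarith [ht.2])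
      linarith
  have hle0 : ∫ x in Ω, Z x * -lap φ x ≤ 0 := le_of_tendsto_of_tendsto hlim htr
    (by filter_upwards [self_mem_nhdsWithin] with t ht using hle t ht)
  have hnn : ∀ x ∈ Ω, 0 ≤ Z x * -lap φ x := fun x hx => by
    by_cases hxc : c / 2 ≤ φ x
    · rw [hZin x hx hxc, zero_mul]
    · exact mul_nonneg (hZ0 x) (neg_nonneg.2 (hφ.lap_neg x hx (by linarith [not_le.1 hxc])).le)
  -- A nonnegative integrand with nonpositive integral vanishes almost everywhere; strict
  -- superharmonicity then leaves only $Z=0$.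
  have hz := (setIntegral_eq_zero_iff_of_nonneg_ae ((ae_restrict_iff' hΩm).2 (ae_of_all _ hnn))
    hZl).1 (le_antisymm hle0 (setIntegral_nonneg hΩm hnn))
  have hO : IsOpen (Ω ∩ {x | φ x < c}) :=
    ho.inter (isOpen_lt hφ.smooth.continuous continuous_const)
  have hZz : Set.EqOn Z (fun _ => 0) (Ω ∩ {x | φ x < c}) := by
    refine Measure.eqOn_open_of_ae_eq (μ := volume) ((ae_restrict_iff' hO.measurableSet).2 ?_) hO
      (fun x hx => (hZc x hx.1).continuousAt.continuousWithinAt) continuousOn_const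
    filter_upwards [(ae_restrict_iff' hΩm).1 hz] with x hx hxO
    exact (mul_eq_zero.1 (hx hxO.1)).resolve_right (neg_ne_zero.2 (hφ.lap_neg x hxO.1 hxO.2).ne)
  intro x hx hxc
  by_contra hlt
  have : 0 < Z x := ramp_pos (by simp only [hm]; linarith [not_le.1 hlt])
  exact this.ne' (hZz ⟨hx, hxc⟩)

theorem lap_const (a : ℝ) (x : Plane) : lap (fun _ => a) x = 0 := by
  have : ∀ (i) (b : ℝ), pd i (fun _ : Plane => b) = fun _ => 0 := fun i b => by
    ext y
    simp [pd]
  simp [lap, this]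

theorem lap_const_sub_norm_sq (A : ℝ) (x : Plane) : lap (fun y => A - ‖y‖ ^ 2) x = -4 := by
  have h1 : ∀ i, pd i (fun y : Plane => A - ‖y‖ ^ 2) = fun y => -(2 * y i) := by
    intro i
    ext y
    have := (hasStrictFDerivAt_norm_sq y).hasFDerivAt.const_sub A
    rw [pd, this.fderiv]
    have := innerSL_single y i
    simp only [smul_apply, neg_apply, this]
    simp
  have h2 : ∀ i, pd i (fun y : Plane => -(2 * y i)) x = -2 := by
    intro i
    have h3 : HasFDerivAt (fun y : Plane => y i) (EuclideanSpace.proj i : Plane →L[ℝ] ℝ) x :=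
      (EuclideanSpace.proj i : Plane →L[ℝ] ℝ).hasFDerivAt
    rw [pd, (h3.const_mul 2).fun_neg.fderiv]
    simp
  simp only [lap, h1, h2]
  norm_num

/-- A maximum principle. -/
theorem nonpos_of_le_mul (hφ : IsBarrier Ω φ c) (ho : IsOpen Ω) (hb : Bornology.IsBounded Ω)
    {h : Plane → ℝ} (hh : ∀ x ∈ Ω, ContDiffAt ℝ 2 h x) (hharm : ∀ x ∈ Ω, lap h x = 0) {C : ℝ}
    (hC : 0 ≤ C) (hle : ∀ x ∈ Ω, φ x < c → h x ≤ C * φ x) : ∀ x ∈ Ω, h x ≤ 0 := by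
  intro x hx
  refine le_of_forall_pos_le_add fun κ hκ => ?_
  rw [zero_add]
  -- Where $\varphi<t$, the bound $C\varphi$ is below $\kappa$; the $+1$ covers $C=0$. Hence the
  -- truncation of $h-\kappa$ has compact support in $\Omega$.
  set t := min c (κ / (C + 1)) with htdef
  have ht : 0 < t := lt_min hφ.level_pos (by positivity)
  set m : Plane → ℝ := fun y => h y + -κ with hm
  have hmc : ∀ y ∈ Ω, ContDiffAt ℝ 2 m y := fun y hy => (hh y hy).add contDiffAt_const
  have hm0 : ∀ y ∈ Ω, φ y < t → m y ≤ 0 := by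
    intro y hy hyt
    have h1 := hle y hy (hyt.trans_le (min_le_left _ _))
    have h2 : φ y * (C + 1) < κ := (lt_div_iff₀ (by linarith)).1 (hyt.trans_le (min_le_right _ _))
    have h3 := hφ.pos y hy
    simp only [hm]
    nlinarith
  have hr2 : ContDiff ℝ 2 ramp := contDiff_ramp.of_le (by norm_cast)
  obtain ⟨hZ, hZc, hZs⟩ := contDiff_indicator_of_eq_zero ho (hφ.isCompact_superlevel hb t)
    (hφ.superlevel_subset ho ht) (f := fun y => ramp (m y)) (n := 2)
    (fun y hy => hr2.contDiffAt.comp y (hmc y hy))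
    (fun y hy hyK => ramp_of_nonpos (hm0 y hy (by
      by_contra hlt
      exact hyK ⟨subset_closure hy, not_lt.1 hlt⟩)))
  set Z := Ω.indicator fun y => ramp (m y) with hZdef
  have hZ0 : ∀ y, 0 ≤ Z y := fun y => Set.indicator_nonneg (fun y _ => ramp_nonneg _) y
  obtain ⟨R, hR⟩ := hb.exists_norm_le
  have hR0 : 0 ≤ R := (norm_nonneg x).trans (hR x hx)
  -- A weight that is nonnegative on $\Omega$ and has Laplacian $-4$: subharmonicity of $Z$ yields
  -- $0\le-4\int Z$, hence $Z=0$.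
  have e := integral_mul_lap_comm (f := fun y => R ^ 2 - ‖y‖ ^ 2) hZ hZc
    fun y _ => (contDiff_const.sub (contDiff_norm_sq ℝ)).contDiffAt
  have hZi : Integrable Z := hZ.continuous.integrable_of_hasCompactSupport hZc
  have hpos : 0 ≤ ∫ y, (R ^ 2 - ‖y‖ ^ 2) * lap Z y := by
    refine integral_nonneg fun y => ?_
    by_cases hy : y ∈ Ω
    · have h1 := hR y hy
      refine mul_nonneg (by nlinarith [norm_nonneg y]) ?_
      have he : Z =ᶠ[𝓝 y] fun y => ramp (m y) := by
        filter_upwards [ho.mem_nhds hy] with w hw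
        exact Set.indicator_of_mem hw _
      rw [(Filter.EventuallyEq.laplacian he).eq_of_nhds, lap_comp hr2 (hmc y hy), hm,
        lap_add (hh y hy) contDiffAt_const, hharm y hy, deriv_ramp]
      rw [lap_const, add_zero, mul_zero, add_zero]
      exact mul_nonneg (deriv_smoothTransition_nonneg _)
        (Finset.sum_nonneg fun _ _ => sq_nonneg _)
    · rw [lap_eq_zero_of_notMem fun h => hy (hφ.superlevel_subset ho ht (hZs h)), mul_zero]
      exact le_rfl
  simp only [e, lap_const_sub_norm_sq, integral_const_mul] at hpos
  have hint : ∫ y, Z y = 0 := le_antisymm (by linarith) (integral_nonneg hZ0)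
  have hz := (integral_eq_zero_iff_of_nonneg hZ0 hZi).1 hint
  have hz' : Z = fun _ => 0 := hZ.continuous.ae_eq_iff_eq volume continuous_const |>.1 hz
  by_contra hlt
  have h1 : 0 < ramp (m x) := ramp_pos (by simp only [hm]; linarith [not_le.1 hlt])
  have h2 := congrFun hz' x
  rw [hZdef, Set.indicator_of_mem hx] at h2
  exact h1.ne' h2

end IsBarrier

/-! ### Zero trace and the distributional equation for Sobolev functions -/

theorem contDiff_sqrt_sq_add {s : ℝ} (hs : 0 < s) :
    ContDiff ℝ ∞ fun x : ℝ => √(x ^ 2 + s ^ 2) - s :=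
  (((contDiff_id.pow 2).add contDiff_const).sqrt fun x => by positivity).sub contDiff_const

theorem abs_deriv_sqrt_sq_add_le {s : ℝ} (hs : 0 < s) (x : ℝ) :
    |deriv (fun x : ℝ => √(x ^ 2 + s ^ 2) - s) x| ≤ 1 := by
  have h0 : 0 < x ^ 2 + s ^ 2 := by positivity
  have h1 : HasDerivAt (fun x : ℝ => √(x ^ 2 + s ^ 2) - s) (2 * x / (2 * √(x ^ 2 + s ^ 2))) x := by
    have h2 : HasDerivAt (fun x : ℝ => x ^ 2 + s ^ 2) (2 * x) x := by
      simpa using (hasDerivAt_pow 2 x).add_const (s ^ 2)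
    exact (h2.sqrt h0.ne').sub_const s
  rw [h1.deriv, mul_div_mul_left _ _ two_ne_zero, abs_div, abs_of_nonneg (Real.sqrt_nonneg _),
    div_le_one (Real.sqrt_pos.2 h0)]
  exact Real.abs_le_sqrt (by nlinarith)

theorem sqrt_sq_add_sub_nonneg (s x : ℝ) : 0 ≤ √(x ^ 2 + s ^ 2) - s :=
  sub_nonneg.2 (Real.le_sqrt_of_sq_le (by nlinarith [sq_nonneg x]))

theorem sqrt_sq_add_sub_le {s : ℝ} (hs : 0 < s) (x : ℝ) : √(x ^ 2 + s ^ 2) - s ≤ |x| := by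
  rw [sub_le_iff_le_add, Real.sqrt_le_left (by positivity)]
  nlinarith [sq_abs x, abs_nonneg x]

theorem abs_le_sqrt_sq_add_sub (s x : ℝ) : |x| ≤ (√(x ^ 2 + s ^ 2) - s) + s := by
  rw [sub_add_cancel]
  exact Real.abs_le_sqrt (by nlinarith [sq_nonneg s])

theorem HasCompactSupport.continuous_mul_integrable {f g : Plane → ℝ} (hgc : HasCompactSupport g)
    (hg : Continuous g) (hf : Continuous f) : Integrable fun x => f x * g x :=
  (hf.mul hg).integrable_of_hasCompactSupport hgc.mul_left

namespace IsBarrier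

variable {Ω : Set Plane} {φ : Plane → ℝ} {c : ℝ}

/-- A trace inequality whose constant does not depend on $t$. The layer weight is
$\Delta(H_t(\varphi))$ minus a bounded term, where $H_t$ is `rampAt t`, and one integration by parts
leaves only $\nabla(H_t(\varphi))$, bounded by $\nabla\varphi$ since $0\le H_t'\le1$. -/
theorem setIntegral_abs_mul_layerWeight_le (hφ : IsBarrier Ω φ c) (ho : IsOpen Ω)
    (hb : Bornology.IsBounded Ω) {M : ℝ} (hM : ∀ x ∈ Ω, |lap φ x| ≤ M ∧ ∀ i, |pd i φ x| ≤ M)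
    {ψ : Plane → ℝ} (hψ : ContDiff ℝ ∞ ψ) (hψc : HasCompactSupport ψ) (hψΩ : tsupport ψ ⊆ Ω)
    {t : ℝ} (ht : 0 < t) :
    ∫ x in Ω, |ψ x| * layerWeight φ t x ≤ ∫ x in Ω, (M * |ψ x| + ∑ i, M * |pd i ψ x|) := by
  have hWc := continuous_layerWeight hφ.smooth t
  have hψi : IntegrableOn (fun x => ψ x) Ω :=
    (hψ.continuous.integrable_of_hasCompactSupport hψc).integrableOn
  have hWi : IntegrableOn (layerWeight φ t) Ω :=
    (hWc.continuousOn.integrableOn_compact hb.isCompact_closure).mono_set subset_closure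
  have hRi : Integrable fun x => M * |ψ x| + ∑ i, M * |pd i ψ x| :=
    (((hψ.continuous.integrable_of_hasCompactSupport hψc).abs.const_mul M)).add
      (integrable_finsetSum _ fun i _ =>
        ((hψ.pderiv_infty i).continuous.integrable_of_hasCompactSupport
        (hψc.pderiv i)).abs.const_mul M)
  have hRset : ∫ x in Ω, (M * |ψ x| + ∑ i, M * |pd i ψ x|) =
      ∫ x, (M * |ψ x| + ∑ i, M * |pd i ψ x|) :=
    setIntegral_eq_integral_of_forall_compl_eq_zero fun x hx => by
      have h1 : ψ x = 0 := image_eq_zero_of_notMem_tsupport fun h => hx (hψΩ h)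
      have h2 : ∀ i, pd i ψ x = 0 := pd_eq_zero_of_notMem fun h => hx (hψΩ h)
      simp [h1, h2]
  have key : ∀ s > 0, ∫ x in Ω, (√(ψ x ^ 2 + s ^ 2) - s) * layerWeight φ t x ≤
      ∫ x in Ω, (M * |ψ x| + ∑ i, M * |pd i ψ x|) := by
    intro s hs
    -- A smooth substitute for the absolute value: it vanishes at $0$, so supports are kept, and it
    -- satisfies $0\le q\le|\cdot|$ and $|q'|\le1$.
    set q : ℝ → ℝ := fun x => √(x ^ 2 + s ^ 2) - s with hq
    have hqs : ContDiff ℝ ∞ q := contDiff_sqrt_sq_add hs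
    have hq0 : q 0 = 0 := by simp [hq, Real.sqrt_sq hs.le]
    set w : Plane → ℝ := fun x => q (ψ x) with hw
    have hws : ContDiff ℝ ∞ w := hqs.comp hψ
    have hwc : HasCompactSupport w := hψc.comp_left hq0
    have hw0 : ∀ x ∉ Ω, w x = 0 := fun x hx => by
      simp only [hw]
      rw [image_eq_zero_of_notMem_tsupport fun h => hx (hψΩ h), hq0]
    have hwpd : ∀ i x, pd i w x = deriv q (ψ x) * pd i ψ x := fun i x =>
      pd_comp (hqs.differentiable (by simp) _) (hψ.differentiable (by simp) _) i
    set G : Plane → ℝ := fun x => rampAt t (φ x) with hG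
    have hGs : ContDiff ℝ ∞ G := (contDiff_rampAt t).comp hφ.smooth
    have hGpd : ∀ i x, pd i G x = Real.smoothTransition (φ x / t - 1) * pd i φ x := fun i x => by
      rw [hG, pd_comp ((contDiff_rampAt t).differentiable (by simp) _)
        (hφ.smooth.differentiable (by simp) _), deriv_rampAt ht]
    have hsc : Continuous fun x => Real.smoothTransition (φ x / t - 1) :=
      Real.smoothTransition.continuous.comp
        ((hφ.smooth.continuous.div_const t).sub continuous_const)
    have e1 := integral_mul_lap_eq_neg_sum (f := G) (hws.of_le (by norm_cast)) hwc
      fun x _ => (hGs.of_le (by norm_cast)).contDiffAt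
    rw [integral_mul_lap_comm (hws.of_le (by norm_cast)) hwc
      fun x _ => (hGs.of_le (by norm_cast)).contDiffAt] at e1
    have i1 : Integrable fun x => layerWeight φ t x * w x :=
      hwc.continuous_mul_integrable hws.continuous hWc
    have i2 : Integrable fun x => Real.smoothTransition (φ x / t - 1) * lap φ x * w x :=
      hwc.continuous_mul_integrable hws.continuous (hsc.mul hφ.smooth.laplacian_infty.continuous)
    have i3 : Integrable fun x => ∑ i, pd i G x * pd i w x := integrable_finsetSum _ fun i _ =>
      (hwc.pderiv i).continuous_mul_integrable (hws.pderiv_infty i).continuous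
        (hGs.pderiv_infty i).continuous
    have e2 : ∫ x, lap G x * w x = (∫ x, layerWeight φ t x * w x) +
        ∫ x, Real.smoothTransition (φ x / t - 1) * lap φ x * w x := by
      rw [← integral_add i1 i2]
      refine integral_congr_ae (ae_of_all _ fun x => ?_)
      simp only [hG, lap_rampAt_comp hφ.smooth ht]
      ring
    have e3 : ∫ x, layerWeight φ t x * w x = ∫ x, (-(∑ i, pd i G x * pd i w x) -
        Real.smoothTransition (φ x / t - 1) * lap φ x * w x) := by
      have i4 : Integrable fun x => -∑ i, pd i G x * pd i w x := i3.neg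
      rw [integral_sub i4 i2, integral_neg]
      linarith
    have e4 : ∫ x in Ω, w x * layerWeight φ t x = ∫ x, layerWeight φ t x * w x := by
      rw [setIntegral_eq_integral_of_forall_compl_eq_zero fun x hx => by rw [hw0 x hx, zero_mul]]
      simp only [mul_comm]
    change ∫ x in Ω, w x * layerWeight φ t x ≤ _
    rw [e4, e3, hRset]
    refine integral_mono (i3.neg.sub i2) hRi fun x => ?_
    have hs1 := Real.smoothTransition.le_one (φ x / t - 1)
    have hs0 := Real.smoothTransition.nonneg (φ x / t - 1)
    by_cases hx : x ∈ Ω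
    · have hw1 : |w x| ≤ |ψ x| := by
        simp only [hw, hq]
        rw [abs_of_nonneg (sqrt_sq_add_sub_nonneg s _)]
        exact sqrt_sq_add_sub_le hs _
      have b1 : -(Real.smoothTransition (φ x / t - 1) * lap φ x * w x) ≤ M * |ψ x| := by
        refine (neg_le_abs _).trans ?_
        rw [abs_mul, abs_mul, abs_of_nonneg hs0]
        refine mul_le_mul ?_ hw1 (abs_nonneg _) ((abs_nonneg _).trans (hM x hx).1)
        exact (mul_le_of_le_one_left (abs_nonneg _) hs1).trans (hM x hx).1
      have b2 : -(∑ i, pd i G x * pd i w x) ≤ ∑ i, M * |pd i ψ x| := by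
        rw [← Finset.sum_neg_distrib]
        refine Finset.sum_le_sum fun i _ => (neg_le_abs _).trans ?_
        rw [hGpd, hwpd, abs_mul, abs_mul, abs_mul, abs_of_nonneg hs0]
        refine mul_le_mul ?_ ?_ (by positivity) ((abs_nonneg _).trans (hM x hx).1)
        · exact (mul_le_of_le_one_left (abs_nonneg _) hs1).trans ((hM x hx).2 i)
        · exact mul_le_of_le_one_left (abs_nonneg _) (abs_deriv_sqrt_sq_add_le hs _)
      simp only
      linarith
    · have h1 : ψ x = 0 := image_eq_zero_of_notMem_tsupport fun h => hx (hψΩ h)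
      have h2 : ∀ i, pd i ψ x = 0 := pd_eq_zero_of_notMem fun h => hx (hψΩ h)
      simp [hwpd, h1, h2, hw0 x hx]
  refine le_of_forall_pos_le_add fun ε hε => ?_
  have hWI : 0 ≤ ∫ x in Ω, layerWeight φ t x :=
    integral_nonneg fun x => layerWeight_nonneg φ ht x
  -- The error of the substitute is at most $s$, so this $s$ costs at most $\varepsilon$ after
  -- integration against the weight.
  set s := ε / ((∫ x in Ω, layerWeight φ t x) + 1) with hs
  have hs0 : 0 < s := by positivity
  have hqi : IntegrableOn (fun x => (√(ψ x ^ 2 + s ^ 2) - s) * layerWeight φ t x) Ω := by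
    refine hφ.integrableOn_mul_layerWeight ho hb ?_ t
    exact (((contDiff_sqrt_sq_add hs0).comp hψ).continuous.integrable_of_hasCompactSupport
      (hψc.comp_left (g := fun x : ℝ => √(x ^ 2 + s ^ 2) - s)
        (by simp [Real.sqrt_sq hs0.le]))).integrableOn
  calc ∫ x in Ω, |ψ x| * layerWeight φ t x
      ≤ ∫ x in Ω, ((√(ψ x ^ 2 + s ^ 2) - s) * layerWeight φ t x + s * layerWeight φ t x) := by
        refine setIntegral_mono (hφ.integrableOn_mul_layerWeight ho hb hψi.abs t)
          (hqi.add (hWi.const_mul s)) fun x => ?_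
        have := mul_le_mul_of_nonneg_right (abs_le_sqrt_sq_add_sub s (ψ x))
          (layerWeight_nonneg φ ht x)
        simpa only [add_mul] using this
    _ = (∫ x in Ω, (√(ψ x ^ 2 + s ^ 2) - s) * layerWeight φ t x) +
        s * ∫ x in Ω, layerWeight φ t x := by
        rw [integral_add hqi (hWi.const_mul s), integral_const_mul]
    _ ≤ _ := by
        refine add_le_add (key s hs0) ?_
        rw [hs, div_mul_eq_mul_div, div_le_iff₀ (by positivity)]
        nlinarith

end IsBarrier

theorem tendsto_integral_norm_of_tendsto_eLpNorm {α E : Type*} [MeasurableSpace α]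
    [NormedAddCommGroup E] {μ : Measure α} [IsFiniteMeasure μ] {p : ℝ≥0∞} (hp : 1 ≤ p)
    {f : ℕ → α → E} (hf : ∀ n, AEStronglyMeasurable (f n) μ)
    (h : Tendsto (fun n => eLpNorm (f n) p μ) atTop (𝓝 0)) :
    Tendsto (fun n => ∫ x, ‖f n x‖ ∂μ) atTop (𝓝 0) := by
  have h1 : Tendsto (fun n => eLpNorm (f n) 1 μ) atTop (𝓝 0) := by
    set K := μ Set.univ ^ (1 / (1 : ℝ≥0∞).toReal - 1 / p.toReal) with hK
    have hKt : K ≠ ⊤ := by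
      refine ENNReal.rpow_ne_top_of_nonneg ?_ (measure_ne_top μ _)
      rcases eq_or_ne p ⊤ with rfl | hpt
      · simp
      · have : 1 ≤ p.toReal := by
          simpa using ENNReal.toReal_mono hpt hp
        rw [sub_nonneg]
        simpa using inv_le_one_of_one_le₀ this
    refine tendsto_of_tendsto_of_tendsto_of_le_of_le tendsto_const_nhds
      (h := fun n => eLpNorm (f n) p μ * K) ?_ (fun n => zero_le)
      fun n => eLpNorm_le_eLpNorm_mul_rpow_measure_univ hp (hf n)
    simpa using ENNReal.Tendsto.mul_const h (Or.inr hKt)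
  have h2 := (ENNReal.tendsto_toReal ENNReal.zero_ne_top).comp h1
  refine h2.congr fun n => ?_
  simp only [Function.comp]
  rw [eLpNorm_one_eq_lintegral_enorm, integral_norm_eq_lintegral_enorm (hf n)]

theorem pd_eq_inner_gradient (f : Plane → ℝ) (x : Plane) (i : Fin 2) :
    pd i f x = inner ℝ (∇ f x) (EuclideanSpace.single i 1) := by
  rw [pd, gradient, InnerProductSpace.toDual_symm_apply]

theorem ContDiff.continuous_gradient {f : Plane → ℝ} (hf : ContDiff ℝ 1 f) : Continuous (∇ f) :=
  (InnerProductSpace.toDual ℝ Plane).symm.continuous.comp (hf.continuous_fderiv (by simp))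

theorem TestFunction.smooth {Ω : TopologicalSpace.Opens Plane} (ψ : 𝓓(Ω, ℝ)) : ContDiff ℝ ∞ ψ :=
  ψ.contDiff

/-- A test function misses all sufficiently thin layers, and the uniform trace inequality controls
differences of test functions in $W^{1,1}$. Density of test functions passes this to $u$; only $L^1$
convergence, available since $\Omega$ is bounded, is used. -/
theorem HasSobolevZeroGradient.zeroTrace {p : ℝ≥0∞} {Ω : TopologicalSpace.Opens Plane}
    {u : Plane → ℝ} {g : Plane → Plane} (h : HasSobolevZeroGradient p Ω u g) (hp : 1 ≤ p)
    (hb : Bornology.IsBounded (Ω : Set Plane)) {φ : Plane → ℝ} {c : ℝ}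
    (hφ : IsBarrier (Ω : Set Plane) φ c) : IsBarrier.ZeroTrace (Ω : Set Plane) φ u := by
  have ho : IsOpen (Ω : Set Plane) := Ω.isOpen
  have : IsFiniteMeasure (volume.restrict (Ω : Set Plane)) :=
    ⟨by simpa using hb.measure_lt_top⟩
  obtain ⟨ψ, hψu, hψg⟩ := h.approx
  have hu : IntegrableOn u (Ω : Set Plane) := h.memLp.integrable hp
  have hg : IntegrableOn g (Ω : Set Plane) := h.memLp_grad.integrable hp
  have hψi : ∀ n, IntegrableOn (ψ n) (Ω : Set Plane) := fun n =>
    ((ψ n).continuous.integrable_of_hasCompactSupport (ψ n).hasCompactSupport).integrableOn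
  have hgc : ∀ n, Continuous (∇ (ψ n)) := fun n =>
    ((ψ n).smooth.of_le (by norm_cast)).continuous_gradient
  have hgi : ∀ n, IntegrableOn (∇ (ψ n)) (Ω : Set Plane) := fun n =>
    ((hgc n).continuousOn.integrableOn_compact hb.isCompact_closure).mono_set subset_closure
  have ha := tendsto_integral_norm_of_tendsto_eLpNorm hp
    (fun n => ((hψi n).sub hu).aestronglyMeasurable) hψu
  have hd := tendsto_integral_norm_of_tendsto_eLpNorm hp
    (fun n => ((hgi n).sub hg).aestronglyMeasurable) hψg
  set a : ℕ → ℝ := fun n => ∫ x in (Ω : Set Plane), ‖ψ n x - u x‖ with hadef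
  set d : ℕ → ℝ := fun n => ∫ x in (Ω : Set Plane), ‖∇ (ψ n) x - g x‖ with hddef
  change Tendsto a atTop (𝓝 0) at ha
  change Tendsto d atTop (𝓝 0) at hd
  have hai : ∀ n, IntegrableOn (fun x => ‖ψ n x - u x‖) (Ω : Set Plane) := fun n =>
    ((hψi n).sub hu).norm
  have hdi : ∀ n, IntegrableOn (fun x => ‖∇ (ψ n) x - g x‖) (Ω : Set Plane) := fun n =>
    ((hgi n).sub hg).norm
  obtain ⟨M, hM0, hM⟩ := hφ.exists_bound hb
  -- The factor $2$ counts the two partial derivatives, each bounded by the norm of the gradient.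
  have hdiff : ∀ m n, ∀ t > 0, ∫ x in (Ω : Set Plane), |ψ m x - ψ n x| * layerWeight φ t x ≤
      M * (a m + a n) + 2 * M * (d m + d n) := by
    intro m n t ht
    have h1 := hφ.setIntegral_abs_mul_layerWeight_le ho hb hM (ψ m - ψ n).smooth
      (ψ m - ψ n).hasCompactSupport (ψ m - ψ n).tsupport_subset ht
    simp only [FunLike.coe_sub, Pi.sub_apply] at h1
    refine h1.trans ?_
    have e : M * (a m + a n) + 2 * M * (d m + d n) = ∫ x in (Ω : Set Plane),
        (M * (‖ψ m x - u x‖ + ‖ψ n x - u x‖) +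
          2 * M * (‖∇ (ψ m) x - g x‖ + ‖∇ (ψ n) x - g x‖)) := by
      have i1 : IntegrableOn (fun x => M * (‖ψ m x - u x‖ + ‖ψ n x - u x‖)) (Ω : Set Plane) :=
        ((hai m).add (hai n)).const_mul M
      have i2 : IntegrableOn (fun x => 2 * M * (‖∇ (ψ m) x - g x‖ + ‖∇ (ψ n) x - g x‖))
          (Ω : Set Plane) := ((hdi m).add (hdi n)).const_mul (2 * M)
      rw [integral_add i1 i2, integral_const_mul, integral_const_mul, integral_add (hai m) (hai n),
        integral_add (hdi m) (hdi n)]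
    rw [e]
    refine integral_mono_of_nonneg (ae_of_all _ fun x => by positivity)
      ((((hai m).add (hai n)).const_mul M).add (((hdi m).add (hdi n)).const_mul (2 * M)))
      (ae_of_all _ fun x => ?_)
    have b1 : |ψ m x - ψ n x| ≤ ‖ψ m x - u x‖ + ‖ψ n x - u x‖ := by
      rw [← Real.norm_eq_abs, ← dist_eq_norm, ← dist_eq_norm, ← dist_eq_norm]
      exact dist_triangle_right _ _ _
    have b2 : ∀ i, |pd i (⇑(ψ m) - ⇑(ψ n)) x| ≤ ‖∇ (ψ m) x - g x‖ + ‖∇ (ψ n) x - g x‖ := by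
      intro i
      have e1 : pd i (⇑(ψ m) - ⇑(ψ n)) x =
          inner ℝ (∇ (ψ m) x - ∇ (ψ n) x) (EuclideanSpace.single i 1) := by
        rw [inner_sub_left, ← pd_eq_inner_gradient, ← pd_eq_inner_gradient, pd, fderiv_sub
          ((ψ m).smooth.differentiable (by simp) x) ((ψ n).smooth.differentiable (by simp) x)]
        rfl
      rw [e1]
      refine (abs_real_inner_le_norm _ _).trans ?_
      rw [PiLp.norm_single, norm_one, mul_one, ← dist_eq_norm, ← dist_eq_norm, ← dist_eq_norm]
      exact dist_triangle_right _ _ _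
    have b3 := mul_le_mul_of_nonneg_left b1 hM0
    have b4 := mul_le_mul_of_nonneg_left (b2 0) hM0
    have b5 := mul_le_mul_of_nonneg_left (b2 1) hM0
    simp only [Fin.sum_univ_two]
    linarith
  have hmain : ∀ n, ∀ t > 0, ∫ x in (Ω : Set Plane), |u x| * layerWeight φ t x ≤
      M * a n + 2 * M * d n + ∫ x in (Ω : Set Plane), |ψ n x| * layerWeight φ t x := by
    intro n t ht
    obtain ⟨K, hK⟩ := hφ.exists_layerWeight_le hb t
    -- The bound $K$ on the weight depends on $t$, so $m\to\infty$ is taken at fixed $t$; the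
    -- surviving bound involves only $n$ and is uniform in $t$.
    have hlim : Tendsto (fun m => K * a m + (M * (a m + a n) + 2 * M * (d m + d n)) +
        ∫ x in (Ω : Set Plane), |ψ n x| * layerWeight φ t x) atTop
        (𝓝 (K * 0 + (M * (0 + a n) + 2 * M * (0 + d n)) +
          ∫ x in (Ω : Set Plane), |ψ n x| * layerWeight φ t x)) :=
      (((ha.const_mul K).add (((ha.add_const _).const_mul M).add
        ((hd.add_const _).const_mul (2 * M)))).add_const _)
    simp only [mul_zero, zero_add] at hlim
    refine ge_of_tendsto' hlim fun m => ?_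
    have i1 : IntegrableOn (fun x => |ψ m x - u x| * layerWeight φ t x) (Ω : Set Plane) :=
      hφ.integrableOn_mul_layerWeight ho hb ((hψi m).sub hu).abs t
    have i2 : IntegrableOn (fun x => |ψ m x - ψ n x| * layerWeight φ t x) (Ω : Set Plane) :=
      hφ.integrableOn_mul_layerWeight ho hb ((hψi m).sub (hψi n)).abs t
    have i12 : IntegrableOn (fun x => |ψ m x - u x| * layerWeight φ t x +
      |ψ m x - ψ n x| * layerWeight φ t x) (Ω : Set Plane) := i1.add i2
    have i3 := hφ.integrableOn_mul_layerWeight ho hb (hψi n).abs t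
    calc ∫ x in (Ω : Set Plane), |u x| * layerWeight φ t x
        ≤ ∫ x in (Ω : Set Plane), (|ψ m x - u x| * layerWeight φ t x +
            |ψ m x - ψ n x| * layerWeight φ t x + |ψ n x| * layerWeight φ t x) := by
          refine setIntegral_mono (hφ.integrableOn_mul_layerWeight ho hb hu.abs t)
            (i12.add i3) fun x => ?_
          rw [← add_mul, ← add_mul]
          refine mul_le_mul_of_nonneg_right ?_ (layerWeight_nonneg φ ht x)
          have h1 := abs_sub_abs_le_abs_sub (u x) (ψ m x)
          have h2 := abs_sub_abs_le_abs_sub (ψ m x) (ψ n x)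
          rw [abs_sub_comm] at h1
          linarith
      _ = (∫ x in (Ω : Set Plane), |ψ m x - u x| * layerWeight φ t x) +
          (∫ x in (Ω : Set Plane), |ψ m x - ψ n x| * layerWeight φ t x) +
          ∫ x in (Ω : Set Plane), |ψ n x| * layerWeight φ t x := by
          rw [integral_add i12 i3, integral_add i1 i2]
      _ ≤ _ := by
          refine add_le_add (add_le_add ?_ (hdiff m n t ht)) le_rfl
          rw [hadef, ← integral_const_mul]
          refine setIntegral_mono_on i1 ((hai m).const_mul K) ho.measurableSet fun x hx => ?_
          rw [mul_comm]
          exact mul_le_mul_of_nonneg_right ((le_abs_self _).trans (hK x hx)) (abs_nonneg _)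
  have hzero : ∀ n, ∀ᶠ t in 𝓝[>] (0 : ℝ),
      ∫ x in (Ω : Set Plane), |ψ n x| * layerWeight φ t x = 0 := by
    intro n
    obtain ⟨δ, hδ, hδ'⟩ := (ψ n).hasCompactSupport.isCompact.exists_forall_le'
      hφ.smooth.continuous.continuousOn (a := 0) fun x hx => hφ.pos x ((ψ n).tsupport_subset hx)
    filter_upwards [Ioo_mem_nhdsGT (half_pos hδ)] with t ht
    refine setIntegral_eq_zero_of_forall_eq_zero fun x _ => ?_
    by_cases hx : x ∈ tsupport (ψ n)
    · rw [layerWeight_eq_zero ht.1 (by linarith [ht.2, hδ' x hx]), mul_zero]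
    · rw [image_eq_zero_of_notMem_tsupport hx, abs_zero, zero_mul]
  have hlim : Tendsto (fun n => M * a n + 2 * M * d n) atTop (𝓝 0) := by
    simpa using (ha.const_mul M).add (hd.const_mul (2 * M))
  rw [IsBarrier.ZeroTrace, tendsto_order]
  refine ⟨fun y hy => ?_, fun y hy => ?_⟩
  · filter_upwards [self_mem_nhdsWithin] with t ht
    exact hy.trans_le (integral_nonneg fun x =>
      mul_nonneg (abs_nonneg _) (layerWeight_nonneg φ ht x))
  · obtain ⟨n, hn⟩ := (hlim.eventually_lt_const hy).exists
    filter_upwards [self_mem_nhdsWithin, hzero n] with t ht h0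
    have := hmain n t ht
    rw [h0, add_zero] at this
    exact this.trans_lt hn

/-- The partial derivatives of a test function are again test functions, so the weak gradient
identity applies to each of them. This trades the variational equation for one that involves no
gradient of $u$. -/
theorem HasSobolevGradient.integral_mul_lap {p : ℝ≥0∞} {Ω : TopologicalSpace.Opens Plane}
    {u : Plane → ℝ} {g : Plane → Plane} (h : HasSobolevGradient p Ω u g) (hp : 1 ≤ p)
    (hb : Bornology.IsBounded (Ω : Set Plane)) (ψ : 𝓓(Ω, ℝ)) :
    ∫ x in (Ω : Set Plane), u x * lap ψ x =
      - ∫ x in (Ω : Set Plane), inner ℝ (g x) (∇ ψ x) := by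
  have : IsFiniteMeasure (volume.restrict (Ω : Set Plane)) :=
    ⟨by simpa using hb.measure_lt_top⟩
  have hu : IntegrableOn u (Ω : Set Plane) := h.memLp.integrable hp
  have hg : IntegrableOn g (Ω : Set Plane) := h.memLp_grad.integrable hp
  have hi : ∀ i, ∫ x in (Ω : Set Plane), u x * pd i (pd i ψ) x =
      - ∫ x in (Ω : Set Plane), inner ℝ (g x) (EuclideanSpace.single i 1) * pd i ψ x := fun i =>
    h.weak_grad ⟨pd i ψ, ψ.smooth.pderiv_infty i, ψ.hasCompactSupport.pderiv i,
      (tsupport_pd_subset i ψ).trans ψ.tsupport_subset⟩ (EuclideanSpace.single i 1)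
  have e : ∀ x, inner ℝ (g x) (∇ ψ x) =
      ∑ i, inner ℝ (g x) (EuclideanSpace.single i 1) * pd i ψ x := by
    intro x
    rw [real_inner_comm, gradient, InnerProductSpace.toDual_symm_apply, fderiv_apply_eq_sum_pd]
    refine Finset.sum_congr rfl fun i _ => ?_
    rw [← innerSL_single]
    rfl
  simp only [e, lap, Finset.mul_sum]
  rw [integral_finsetSum, integral_finsetSum, ← Finset.sum_neg_distrib]
  · exact Finset.sum_congr rfl fun i _ => hi i
  · intro i _
    obtain ⟨N, _, hN⟩ := exists_bound_of_compactSupport (ψ.smooth.pderiv_infty i).continuous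
      (ψ.hasCompactSupport.pderiv i)
    exact (hg.inner_const _).mul_bdd (c := N)
      (ψ.smooth.pderiv_infty i).continuous.aestronglyMeasurable (ae_of_all _ hN)
  · intro i _
    obtain ⟨N, _, hN⟩ := exists_bound_of_compactSupport
      ((ψ.smooth.pderiv_infty i).pderiv_infty i).continuous
      ((ψ.hasCompactSupport.pderiv i).pderiv i)
    exact hu.mul_bdd (c := N)
      ((ψ.smooth.pderiv_infty i).pderiv_infty i).continuous.aestronglyMeasurable (ae_of_all _ hN)

/-! ### Construction of barriers -/

theorem lap_affine_sq (A : ℝ) (b c x : Plane) :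
    pd 0 (fun y => A - inner ℝ b (y - c) ^ 2) x = -2 * inner ℝ b (x - c) * b 0 ∧
    pd 1 (fun y => A - inner ℝ b (y - c) ^ 2) x = -2 * inner ℝ b (x - c) * b 1 ∧
    lap (fun y => A - inner ℝ b (y - c) ^ 2) x = -2 * ‖b‖ ^ 2 := by
  have h0 : ∀ y, HasFDerivAt (fun y => (inner ℝ b (y - c) : ℝ)) (innerSL ℝ b) y := fun y =>
    ((innerSL ℝ b).hasFDerivAt.comp y ((hasFDerivAt_id y).sub_const c))
  have h1 : ∀ i, pd i (fun y => A - inner ℝ b (y - c) ^ 2) =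
      fun y => -2 * inner ℝ b (y - c) * b i := by
    intro i
    ext y
    have h2 := ((h0 y).pow 2).const_sub A
    rw [pd, h2.fderiv]
    have := innerSL_single b i
    simp only [smul_apply, neg_apply, this]
    simp
  have h2 : ∀ i, pd i (fun y => -2 * inner ℝ b (y - c) * b i) x = -2 * b i ^ 2 := by
    intro i
    have h2 := ((h0 x).const_mul (-2)).mul_const (b i)
    rw [pd, h2.fderiv]
    have := innerSL_single b i
    simp only [smul_apply, this]
    simp
    ring
  refine ⟨by rw [h1], by rw [h1], ?_⟩
  simp only [lap, h1, h2, EuclideanSpace.norm_sq_eq, Fin.sum_univ_two, Real.norm_eq_abs, sq_abs]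
  ring

/-- The product of $L^2-\langle b_i,x-c\rangle^2$ over both axes works: the cross term in the
Laplacian vanishes by orthogonality and the other two are negative. It is superharmonic in the whole
square, so the level $1$ is arbitrary. -/
theorem IsOpenSquare.exists_isBarrier {Ω : Set Plane} (h : IsOpenSquare Ω) :
    ∃ φ c, IsBarrier Ω φ c := by
  obtain ⟨c, b, L, hL, rfl⟩ := h
  simp only [OrthonormalBasis.repr_apply_apply]
  have hs : ∀ i, ContDiff ℝ ∞ fun y : Plane => L ^ 2 - inner ℝ (b i) (y - c) ^ 2 := fun i =>
    contDiff_const.sub ((contDiff_const.inner ℝ (contDiff_id.sub contDiff_const)).pow 2)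
  have hpos : ∀ x ∈ {x : Plane | ∀ i, |inner ℝ (b i) (x - c)| < L}, ∀ i,
      0 < L ^ 2 - inner ℝ (b i) (x - c) ^ 2 := fun x hx i => by
    have := sq_lt_sq' (abs_lt.1 (hx i)).1 (abs_lt.1 (hx i)).2
    linarith
  have hab : ∀ i, Continuous fun x : Plane => |inner ℝ (b i) (x - c)| := fun i => by fun_prop
  have ho : IsOpen {x : Plane | ∀ i, |inner ℝ (b i) (x - c)| < L} := by
    simp only [Set.ofPred_forall]
    exact isOpen_iInter_of_finite fun i => isOpen_lt (hab i) continuous_const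
  refine ⟨fun y => (L ^ 2 - inner ℝ (b 0) (y - c) ^ 2) * (L ^ 2 - inner ℝ (b 1) (y - c) ^ 2), 1,
    (hs 0).mul (hs 1), fun x hx => mul_pos (hpos x hx 0) (hpos x hx 1), fun x hx => ?_, one_pos,
    fun x hx _ => ?_⟩
  · have hcl : ∀ i, |inner ℝ (b i) (x - c)| ≤ L := fun i =>
      closure_minimal (fun y hy => (hy i).le : _ ⊆ {y : Plane | |inner ℝ (b i) (y - c)| ≤ L})
        (isClosed_le (hab i) continuous_const) hx.1
    have hn : ¬ ∀ i, |inner ℝ (b i) (x - c)| < L := by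
      have := hx.2
      rw [ho.interior_eq] at this
      exact this
    push Not at hn
    obtain ⟨i, hi⟩ := hn
    have e : L ^ 2 - inner ℝ (b i) (x - c) ^ 2 = 0 := by
      rw [← sq_abs (inner ℝ (b i) (x - c)), le_antisymm (hcl i) hi, sub_self]
    fin_cases i
    · exact mul_eq_zero_of_left e _
    · exact mul_eq_zero_of_right _ e
  · have h01 : b 0 0 * b 1 0 + b 0 1 * b 1 1 = 0 := by
      have := b.inner_eq_zero (show (0 : Fin 2) ≠ 1 by decide)
      rw [PiLp.inner_apply, Fin.sum_univ_two] at this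
      simpa [mul_comm] using this
    obtain ⟨p0, p1, l0⟩ := lap_affine_sq (L ^ 2) (b 0) c x
    obtain ⟨q0, q1, l1⟩ := lap_affine_sq (L ^ 2) (b 1) c x
    rw [lap_mul ((hs 0).contDiffAt.of_le (by norm_cast)) ((hs 1).contDiffAt.of_le (by norm_cast)),
      Fin.sum_univ_two, p0, p1, l0, q0, q1, l1, b.norm_eq_one, b.norm_eq_one]
    have h0 := hpos x hx 0
    have h1 := hpos x hx 1
    have e : -2 * inner ℝ (b 0) (x - c) * b 0 0 * (-2 * inner ℝ (b 1) (x - c) * b 1 0) +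
        -2 * inner ℝ (b 0) (x - c) * b 0 1 * (-2 * inner ℝ (b 1) (x - c) * b 1 1) = 0 := by
      linear_combination (4 * inner ℝ (b 0) (x - c) * inner ℝ (b 1) (x - c)) * h01
    rw [e]
    linarith

theorem eventually_lt_of_fderiv_pos {f : Plane → ℝ} {x v : Plane} (hf : DifferentiableAt ℝ f x)
    (h : 0 < fderiv ℝ f x v) : ∀ᶠ s in 𝓝[>] (0 : ℝ), f x < f (x + s • v) := by
  have h1 : HasDerivAt (fun s : ℝ => x + s • v) v 0 := by
    simpa using ((hasDerivAt_id (0 : ℝ)).smul_const v).const_add x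
  have h2 : HasDerivAt (fun s : ℝ => f (x + s • v)) (fderiv ℝ f x v) 0 := by
    have h3 : HasFDerivAt f (fderiv ℝ f x) (x + (0 : ℝ) • v) := by simpa using hf.hasFDerivAt
    exact h3.comp_hasDerivAt 0 h1
  filter_upwards [h2.tendsto_slope_zero_right.eventually_const_lt h, self_mem_nhdsWithin]
    with s hs hs0
  have hs0' : (0 : ℝ) < s := hs0
  simp only [zero_add, zero_smul, add_zero, smul_eq_mul] at hs
  have := (pos_iff_pos_of_mul_pos hs).1 (inv_pos.2 hs0')
  linarith

/-- Finitely many local functions $-\rho_q$ are patched with bumps $\chi_q$. A smooth nonnegative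
$\eta$ with support set $\Omega$ secures positivity away from the patches without affecting the
differential on the boundary. -/
theorem HasSmoothBoundary.exists_definingFunction {Ω : Set Plane} (h : HasSmoothBoundary Ω)
    (ho : IsOpen Ω) (hb : Bornology.IsBounded Ω) :
    ∃ f : Plane → ℝ, ContDiff ℝ ∞ f ∧ (∀ x ∈ Ω, 0 < f x) ∧ (∀ x ∈ frontier Ω, f x = 0) ∧
      ∀ x ∈ frontier Ω, fderiv ℝ f x ≠ 0 := by
  have hloc : ∀ q ∈ frontier Ω, ∃ ρ : Plane → ℝ, ∃ R > 0, ContDiff ℝ ∞ ρ ∧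
      ∀ x ∈ Metric.ball q R, fderiv ℝ ρ x ≠ 0 ∧ (x ∈ Ω ↔ ρ x < 0) := by
    intro q hq
    obtain ⟨ρ, hρ, hd, hev⟩ := h q hq
    have hev' := ((hρ.continuous_fderiv (by simp)).continuousAt.eventually_ne hd).and hev
    obtain ⟨R, hR, hR'⟩ := Metric.eventually_nhds_iff_ball.1 hev'
    exact ⟨ρ, R, hR, hρ, hR'⟩
  choose! ρ R hR hρ hball using hloc
  have hfc : IsCompact (frontier Ω) := hb.isCompact_closure.of_isClosed_subset isClosed_frontier
    frontier_subset_closure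
  obtain ⟨T, hT, hcov⟩ := hfc.elim_nhds_subcover (fun q => Metric.ball q (R q / 2))
    fun q hq => Metric.ball_mem_nhds q (half_pos (hR q hq))
  have hbump : ∀ q : Plane, ∃ χ : Plane → ℝ, ContDiff ℝ ∞ χ ∧ (∀ x, 0 ≤ χ x) ∧
      (q ∈ frontier Ω → (∀ x, χ x ≠ 0 → x ∈ Metric.ball q (R q)) ∧
        ∀ x ∈ Metric.ball q (R q / 2), χ x = 1) := by
    intro q
    by_cases hq : q ∈ frontier Ω
    · let χ : ContDiffBump q := ⟨R q / 2, R q, half_pos (hR q hq), half_lt_self (hR q hq)⟩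
      refine ⟨χ, χ.contDiff, fun x => χ.nonneg, fun _ => ⟨fun x hx => ?_, fun x hx => ?_⟩⟩
      · have : x ∈ Function.support χ := hx
        rwa [χ.support_eq] at this
      · exact χ.one_of_mem_closedBall (Metric.ball_subset_closedBall hx)
    · exact ⟨fun _ => 0, contDiff_const, fun _ => le_rfl, fun h => absurd h hq⟩
  choose χ hχ hχ0 hχq using hbump
  obtain ⟨η, hηs, hη, hηr⟩ := ho.exists_contDiff_support_eq (n := ⊤)
  have hη0 : ∀ x, 0 ≤ η x := fun x => (hηr ⟨x, rfl⟩).1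
  -- A boundary point is not in $\Omega$, which gives $\rho_q\ge0$, and is a limit of points of
  -- $\Omega$, which gives $\rho_q\le0$.
  have hpd : ∀ x ∈ frontier Ω, ∀ q ∈ frontier Ω, χ q x ≠ 0 → ρ q x = 0 := by
    intro x hx q hq hxq
    have hxb := (hχq q hq).1 x hxq
    have hxΩ : x ∉ Ω := fun h => hx.2 (by rwa [ho.interior_eq])
    refine le_antisymm ?_ (not_lt.1 fun hlt => hxΩ (((hball q hq x hxb).2).2 hlt))
    have hfr : ∃ᶠ y in 𝓝 x, y ∈ Ω := mem_closure_iff_frequently.1 hx.1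
    refine le_of_not_gt fun hgt => hfr ?_
    filter_upwards [Metric.isOpen_ball.mem_nhds hxb,
      (hρ q hq).continuous.continuousAt.eventually_const_lt hgt] with y h1 h2 h3
    exact absurd (((hball q hq y h1).2).1 h3) h2.not_gt
  refine ⟨fun x => (∑ q ∈ T, χ q x * -ρ q x) + η x, ?_, fun x hx => ?_, fun x hx => ?_,
    fun x hx => ?_⟩
  · exact (ContDiff.sum fun q hq => (hχ q).mul (hρ q (hT q hq)).neg).add hη
  · refine add_pos_of_nonneg_of_pos (Finset.sum_nonneg fun q hq => ?_)
      ((hη0 x).lt_of_ne' (show x ∈ Function.support η by rwa [hηs]))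
    by_cases hxq : χ q x = 0
    · rw [hxq, zero_mul]
    · exact mul_nonneg (hχ0 q x) (neg_nonneg.2 (((hball q (hT q hq) x
        ((hχq q (hT q hq)).1 x hxq)).2).1 hx).le)
  · have hxΩ : x ∉ Ω := fun h => hx.2 (by rwa [ho.interior_eq])
    have hηx : η x = 0 := by
      by_contra hne
      exact hxΩ (hηs ▸ (show x ∈ Function.support η from hne))
    simp only [hηx, add_zero]
    refine Finset.sum_eq_zero fun q hq => ?_
    by_cases hxq : χ q x = 0
    · rw [hxq, zero_mul]
    · rw [hpd x hx q (hT q hq) hxq, neg_zero, mul_zero]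
  · have hxΩ : x ∉ Ω := fun h => hx.2 (by rwa [ho.interior_eq])
    have hηx : η x = 0 := by
      by_contra hne
      exact hxΩ (hηs ▸ (show x ∈ Function.support η from hne))
    -- Nonnegative functions have zero differential at their zeros; this disposes of $\eta$ and of
    -- the bumps that vanish at $x$.
    have hmin : ∀ f : Plane → ℝ, (∀ y, 0 ≤ f y) → f x = 0 → fderiv ℝ f x = 0 := fun f h0 hz =>
      IsLocalMin.fderiv_eq_zero (Eventually.of_forall fun y => hz.le.trans (h0 y))
    have hterm : ∀ q ∈ T, HasFDerivAt (fun x => χ q x * -ρ q x)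
        (-(χ q x • fderiv ℝ (ρ q) x)) x := by
      intro q hq
      have h1 := ((hχ q).differentiable (by simp) x).hasFDerivAt
      have h2 := ((hρ q (hT q hq)).differentiable (by simp) x).hasFDerivAt
      have h3 := h1.mul h2.fun_neg
      have h4 : -ρ q x • fderiv ℝ (χ q) x = 0 := by
        by_cases hxq : χ q x = 0
        · rw [hmin _ (hχ0 q) hxq, smul_zero]
        · rw [hpd x hx q (hT q hq) hxq, neg_zero, zero_smul]
      rw [h4, add_zero, smul_neg] at h3
      exact h3
    have hder := (HasFDerivAt.fun_sum hterm).fun_add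
      (hη.differentiable (by simp) x).hasFDerivAt
    rw [hmin η hη0 hηx, add_zero] at hder
    rw [hder.fderiv]
    obtain ⟨q₀, hq₀T, hxq₀⟩ := Set.mem_iUnion₂.1 (hcov hx)
    have hq₀ := hT q₀ hq₀T
    have hχ₀ : χ q₀ x = 1 := (hχq q₀ hq₀).2 x hxq₀
    have hxb₀ := (hχq q₀ hq₀).1 x (by rw [hχ₀]; exact one_ne_zero)
    obtain ⟨v, hv⟩ : ∃ v, 0 < fderiv ℝ (ρ q₀) x v := by
      by_contra! hcon
      refine (hball q₀ hq₀ x hxb₀).1 (ContinuousLinearMap.ext fun v => ?_)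
      have h1 := hcon v
      have h2 := hcon (-v)
      rw [map_neg] at h2
      simp only [zero_apply]
      linarith
    -- Local defining functions cannot have opposite signs of derivative along $v$: a short step
    -- along $v$ would land both inside and outside $\Omega$. Hence the differentials do not cancel
    -- in the sum.
    have hnn : ∀ q ∈ T, 0 ≤ χ q x * fderiv ℝ (ρ q) x v := by
      intro q hq
      by_cases hxq : χ q x = 0
      · rw [hxq, zero_mul]
      refine mul_nonneg (hχ0 q x) (not_lt.1 fun hlt => ?_)
      have hqf := hT q hq
      have hxb := (hχq q hqf).1 x hxq
      have hdq := (hρ q hqf).differentiable (by simp) x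
      have e1 := eventually_lt_of_fderiv_pos ((hρ q₀ hq₀).differentiable (by simp) x) hv
      have e2 := eventually_lt_of_fderiv_pos (f := fun y => -ρ q y) (v := v) hdq.fun_neg (by
        rw [fderiv_fun_neg]
        simpa using hlt)
      have hcont : Tendsto (fun s : ℝ => x + s • v) (𝓝[>] 0) (𝓝 x) := by
        have : Continuous fun s : ℝ => x + s • v := by fun_prop
        have := this.tendsto 0
        rw [zero_smul, add_zero] at this
        exact this.mono_left nhdsWithin_le_nhds
      have e3 := hcont.eventually (Metric.isOpen_ball.mem_nhds hxb)
      have e4 := hcont.eventually (Metric.isOpen_ball.mem_nhds hxb₀)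
      obtain ⟨s, h1, h2, h3, h4⟩ := (e1.and (e2.and (e3.and e4))).exists
      rw [hpd x hx q₀ hq₀ (by rw [hχ₀]; exact one_ne_zero)] at h1
      rw [hpd x hx q hqf hxq] at h2
      have h5 : x + s • v ∈ Ω := ((hball q hqf _ h3).2).2 (by linarith)
      exact absurd (((hball q₀ hq₀ _ h4).2).1 h5) h1.not_gt
    intro hzero
    have h1 := congrArg (fun L : Plane →L[ℝ] ℝ => L v) hzero
    have h2 : ∑ q ∈ T, χ q x * fderiv ℝ (ρ q) x v = 0 := by
      have : -∑ q ∈ T, χ q x * fderiv ℝ (ρ q) x v = 0 := by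
        simpa [sum_apply] using h1
      linarith
    have h3 := (Finset.sum_eq_zero_iff_of_nonneg hnn).1 h2 q₀ hq₀T
    rw [hχ₀, one_mul] at h3
    exact hv.ne' h3

/-- Composing a defining function $f$ with the concave $1-e^{-Ky}$ gives Laplacian $Ke^{-Kf}(\Delta
f-K|\nabla f|^2)$. Near the boundary $|\nabla f|$ is bounded below, so a large $K$ makes this
negative. -/
theorem HasSmoothBoundary.exists_isBarrier {Ω : Set Plane} (h : HasSmoothBoundary Ω)
    (ho : IsOpen Ω) (hb : Bornology.IsBounded Ω) : ∃ φ c, IsBarrier Ω φ c := by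
  obtain ⟨f, hf, hpos, hzero, hder⟩ := h.exists_definingFunction ho hb
  have hfc : IsCompact (frontier Ω) := hb.isCompact_closure.of_isClosed_subset isClosed_frontier
    frontier_subset_closure
  set s : Plane → ℝ := fun x => ∑ i, pd i f x ^ 2 with hs
  have hsc : Continuous s := continuous_finsetSum _ fun i _ => (hf.pderiv_infty i).continuous.pow 2
  have hspos : ∀ x ∈ frontier Ω, 0 < s x := by
    intro x hx
    refine (Finset.sum_nonneg fun i _ => sq_nonneg _).lt_of_ne' fun hz => hder x hx ?_
    have hz' := (Finset.sum_eq_zero_iff_of_nonneg fun i _ => sq_nonneg (pd i f x)).1 hz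
    ext v
    rw [fderiv_apply_eq_sum_pd]
    simp [fun i => pow_eq_zero_iff (two_ne_zero) |>.1 (hz' i (Finset.mem_univ i))]
  obtain ⟨m, hm, hm'⟩ := hfc.exists_forall_le' hsc.continuousOn (a := 0) hspos
  obtain ⟨M, hM⟩ := hb.isCompact_closure.exists_bound_of_continuousOn
    hf.laplacian_infty.continuous.continuousOn
  -- Ensures $K\cdot m/2>\max(M,0)\ge\Delta f$ on $\Omega$, where $m/2$ is the lower bound for
  -- $|\nabla f|^2$ retained near the boundary.
  set K := 2 * max M 0 / m + 1 with hK
  have hK0 : 0 < K := by positivity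
  set b : ℝ → ℝ := fun y => 1 - Real.exp (-K * y) with hbdef
  have hbs : ContDiff ℝ ∞ b :=
    contDiff_const.sub (Real.contDiff_exp.comp (contDiff_const.mul contDiff_id))
  have he : ∀ y, HasDerivAt (fun y : ℝ => Real.exp (-K * y)) (Real.exp (-K * y) * -K) y := by
    intro y
    simpa using ((hasDerivAt_id y).const_mul (-K)).exp
  have hb1 : deriv b = fun y => K * Real.exp (-K * y) := by
    ext y
    rw [hbdef, ((he y).const_sub 1).deriv]
    ring
  have hb2 : deriv (deriv b) = fun y => -K ^ 2 * Real.exp (-K * y) := by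
    rw [hb1]
    ext y
    rw [((he y).const_mul K).deriv]
    ring
  have hφs : ContDiff ℝ ∞ fun x => b (f x) := hbs.comp hf
  have hφpos : ∀ x ∈ Ω, 0 < b (f x) := fun x hx => by
    simp only [hbdef, sub_pos, Real.exp_lt_one_iff]
    nlinarith [hpos x hx]
  have hN : IsOpen {x | m / 2 < s x} := isOpen_lt continuous_const hsc
  have hcc : IsCompact (closure Ω \ {x | m / 2 < s x}) := hb.isCompact_closure.diff hN
  have hcΩ : closure Ω \ {x | m / 2 < s x} ⊆ Ω := by
    rintro x ⟨hx, hxs⟩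
    by_contra hxΩ
    have hfr : x ∈ frontier Ω := ⟨hx, by rwa [ho.interior_eq]⟩
    exact hxs (show m / 2 < s x by linarith [hm' x hfr])
  -- Points of $\Omega$ with small gradient form a compact subset, where the barrier is at least
  -- some $c>0$; below the level $c$ the gradient bound therefore holds.
  obtain ⟨c, hc, hc'⟩ := hcc.exists_forall_le' hφs.continuous.continuousOn (a := 0)
    fun x hx => hφpos x (hcΩ hx)
  refine ⟨fun x => b (f x), c, hφs, hφpos, fun x hx => ?_, hc, fun x hx hxc => ?_⟩
  · simp [hbdef, hzero x hx]
  · have hxs : m / 2 < s x := by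
      by_contra hlt
      exact absurd (hc' x ⟨subset_closure hx, hlt⟩) (not_le.2 hxc)
    rw [lap_comp (hbs.of_le (by norm_cast)) (hf.contDiffAt.of_le (by norm_cast)), hb2, hb1]
    have h1 : lap f x ≤ max M 0 :=
      ((le_abs_self _).trans (hM x (subset_closure hx))).trans (le_max_left _ _)
    have h2 : max M 0 < K * s x := by
      calc max M 0 < K * (m / 2) := by
            rw [hK]
            field_simp
            linarith
        _ ≤ K * s x := mul_le_mul_of_nonneg_left hxs.le hK0.le
    have h3 : -K ^ 2 * Real.exp (-K * f x) * s x + K * Real.exp (-K * f x) * lap f x =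
        K * Real.exp (-K * f x) * (lap f x - K * s x) := by ring
    change -K ^ 2 * Real.exp (-K * f x) * s x + K * Real.exp (-K * f x) * lap f x < 0
    rw [h3]
    exact mul_neg_of_pos_of_neg (by positivity) (by linarith)

/-! ### The compactly supported correction potential -/

theorem lap_comp_add_left (f : Plane → ℝ) (a t : Plane) :
    lap (fun t => f (a + t)) t = lap f (a + t) := by
  have h : ∀ (g : Plane → ℝ) i, pd i (fun t => g (a + t)) = fun t => pd i g (a + t) := fun g i => by
    ext t
    rw [pd, fderiv_comp_add_left, pd]
  simp only [lap, h]

/-- A function vanishing outside the ball, whose distributional Laplacian is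
`ballBump x₀ ε - δ`. -/
theorem exists_potential_ballBump (x₀ : Plane) {ε : ℝ} (hε : 0 < ε) :
    ∃ w : Plane → ℝ, Integrable w ∧ (∀ x ∉ Metric.ball x₀ ε, w x = 0) ∧
      ∀ ψ : Plane → ℝ, ContDiff ℝ ∞ ψ → HasCompactSupport ψ →
        ∫ x, w x * lap ψ x = (∫ x, ballBump x₀ ε x * ψ x) - ψ x₀ := by
  set k := KernelPair.potential (fun z => max (1 - ‖z‖ ^ 2) 0 / (2 * Real.pi)) ε with hk
  refine ⟨fun x => k (x - x₀), (kernelPair_ball.integrable_potential ε).comp_sub_right x₀,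
    fun x hx => kernelPair_ball.potential_eq_zero ?_, fun ψ hψ hψc => ?_⟩
  · rw [mem_ball_iff_norm] at hx
    exact not_lt.1 hx
  · have hs : ContDiff ℝ ∞ fun t => ψ (x₀ + t) := hψ.comp (contDiff_const.add contDiff_id)
    have hsc : HasCompactSupport fun t => ψ (x₀ + t) :=
      hψc.comp_homeomorph (Homeomorph.addLeft x₀)
    have e := kernelPair_ball.integral_potential_mul_lap hs hsc hε.le
    simp only [lap_comp_add_left, add_zero] at e
    rw [← integral_add_left_eq_self _ x₀]
    simp only [add_sub_cancel_left]
    rw [e]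
    congr 1
    rw [← integral_add_left_eq_self (fun x => ballBump x₀ ε x * ψ x) x₀]
    have e2 := Measure.integral_comp_inv_smul_of_nonneg (volume : Measure Plane)
      (fun z => (Metric.ball (0 : Plane) 1).indicator (fun _ => 1 / Real.pi) z * ψ (x₀ + ε • z))
      hε.le
    simp only [smul_inv_smul₀ hε.ne'] at e2
    have e3 : ∀ x, ballBump x₀ ε (x₀ + x) * ψ (x₀ + x) = (ε ^ 2)⁻¹ *
        ((Metric.ball (0 : Plane) 1).indicator (fun _ => 1 / Real.pi) (ε⁻¹ • x) * ψ (x₀ + x)) := by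
      intro x
      have hiff : x₀ + x ∈ Metric.ball x₀ ε ↔ ε⁻¹ • x ∈ Metric.ball (0 : Plane) 1 := by
        rw [mem_ball_iff_norm, mem_ball_zero_iff, add_sub_cancel_left, norm_smul, norm_inv,
          Real.norm_of_nonneg hε.le, inv_mul_eq_div, div_lt_one hε]
      by_cases hx : x₀ + x ∈ Metric.ball x₀ ε
      · rw [ballBump, Set.indicator_of_mem hx, Set.indicator_of_mem (hiff.1 hx)]
        have := Real.pi_ne_zero
        have := hε.ne'
        field_simp
      · rw [ballBump, Set.indicator_of_notMem hx, Set.indicator_of_notMem (hiff.not.1 hx)]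
        simp
    simp only [e3, integral_const_mul]
    rw [e2]
    have := hε.ne'
    simp
    field_simp

/-! ### Uniqueness and continuity up to the boundary -/

namespace IsBarrier

variable {Ω : Set Plane} {φ : Plane → ℝ} {c : ℝ}

theorem mono (hφ : IsBarrier Ω φ c) {c' : ℝ} (hc : 0 < c') (hcc : c' ≤ c) : IsBarrier Ω φ c' :=
  { hφ with
    level_pos := hc
    lap_neg := fun x hx h => hφ.lap_neg x hx (h.trans_le hcc) }

theorem ZeroTrace.neg {u : Plane → ℝ} (h : ZeroTrace Ω φ u) : ZeroTrace Ω φ fun x => -u x := by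
  simpa only [ZeroTrace, abs_neg] using h

theorem ZeroTrace.congr {u v : Plane → ℝ} (h : ZeroTrace Ω φ u) (ho : IsOpen Ω)
    (huv : ∀ᶠ t in 𝓝[>] 0, ∀ x ∈ Ω, layerWeight φ t x ≠ 0 → u x = v x) : ZeroTrace Ω φ v := by
  refine Tendsto.congr' ?_ h
  filter_upwards [huv] with t ht
  refine setIntegral_congr_fun ho.measurableSet fun x hx => ?_
  by_cases hw : layerWeight φ t x = 0
  · simp [hw]
  · simp only [ht x hx hw]

theorem ZeroTrace.sub (hφ : IsBarrier Ω φ c) (ho : IsOpen Ω) (hb : Bornology.IsBounded Ω)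
    {u v : Plane → ℝ} (hu : IntegrableOn u Ω) (hv : IntegrableOn v Ω) (h : ZeroTrace Ω φ u)
    (h' : ZeroTrace Ω φ v) : ZeroTrace Ω φ fun x => u x - v x := by
  have hs : Tendsto (fun t => (∫ x in Ω, |u x| * layerWeight φ t x) +
      ∫ x in Ω, |v x| * layerWeight φ t x) (𝓝[>] 0) (𝓝 0) := by
    simpa using Tendsto.add h h'
  refine tendsto_of_tendsto_of_tendsto_of_le_of_le' tendsto_const_nhds hs ?_ ?_
  · filter_upwards [self_mem_nhdsWithin] with t ht
    exact integral_nonneg fun x => mul_nonneg (abs_nonneg _) (layerWeight_nonneg φ ht x)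
  · filter_upwards [self_mem_nhdsWithin] with t ht
    have i1 := hφ.integrableOn_mul_layerWeight ho hb hu.abs t
    have i2 := hφ.integrableOn_mul_layerWeight ho hb hv.abs t
    rw [← integral_add i1 i2]
    refine setIntegral_mono (hφ.integrableOn_mul_layerWeight ho hb (hu.sub hv).abs t)
      (i1.add i2) fun x => ?_
    have := mul_le_mul_of_nonneg_right (abs_sub (u x) (v x)) (layerWeight_nonneg φ ht x)
    simpa only [add_mul] using this

theorem abs_le_mul_of_zeroTrace (hφ : IsBarrier Ω φ c) (ho : IsOpen Ω)
    (hb : Bornology.IsBounded Ω) {h u : Plane → ℝ} (hh : ∀ x ∈ Ω, ContDiffAt ℝ 2 h x)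
    (hharm : ∀ x ∈ Ω, φ x < c → lap h x = 0) (hu : IntegrableOn u Ω) (htr : ZeroTrace Ω φ u)
    (hae : ∀ᵐ x, x ∈ Ω → φ x < c → h x = u x) :
    ∃ C, 0 ≤ C ∧ ∀ x ∈ Ω, φ x < c → |h x| ≤ C * φ x := by
  obtain ⟨C, hC, h1⟩ := hφ.le_mul_of_zeroTrace ho hb hh hharm hu htr hae
  have hl : ∀ x ∈ Ω, lap (fun y => -h y) x = -lap h x := fun x hx => by
    have := lap_const_mul (-1) (hh x hx)
    simpa only [neg_one_mul] using this
  obtain ⟨C', hC', h2⟩ := hφ.le_mul_of_zeroTrace ho hb (h := fun y => -h y) (u := fun y => -u y)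
    (fun x hx => (hh x hx).neg) (fun x hx hxc => by rw [hl x hx, hharm x hx hxc, neg_zero])
    hu.neg htr.neg (hae.mono fun x hx h3 h4 => by rw [hx h3 h4])
  refine ⟨C + C', add_nonneg hC hC', fun x hx hxc => abs_le.2 ⟨?_, ?_⟩⟩
  · have := h2 x hx hxc
    nlinarith [mul_nonneg hC (hφ.pos x hx).le]
  · have := h1 x hx hxc
    nlinarith [mul_nonneg hC' (hφ.pos x hx).le]

/-- Weyl's lemma supplies a harmonic version, the zero trace gives it the decay $|F|\le C\varphi$,
and the maximum principle applies to $\pm F$. -/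
theorem ae_eq_zero_of_weaklyHarmonic (hφ : IsBarrier Ω φ c) (ho : IsOpen Ω)
    (hb : Bornology.IsBounded Ω) {u : Plane → ℝ} (hu : Integrable u) (htr : ZeroTrace Ω φ u)
    (hw : WeaklyHarmonic Ω u) : ∀ᵐ x, x ∈ Ω → u x = 0 := by
  obtain ⟨F, hF, hFu, hFl⟩ := hw.exists_harmonic ho hu
  have hF2 : ∀ x ∈ Ω, ContDiffAt ℝ 2 F x := fun x hx => (hF x hx).of_le (by norm_cast)
  obtain ⟨C, hC, hCF⟩ := hφ.abs_le_mul_of_zeroTrace ho hb hF2 (fun x hx _ => hFl x hx)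
    hu.integrableOn htr (hFu.mono fun x hx h1 _ => hx h1)
  have h1 := hφ.nonpos_of_le_mul ho hb hF2 hFl hC fun x hx hxc =>
    (le_abs_self _).trans (hCF x hx hxc)
  have h2 := hφ.nonpos_of_le_mul ho hb (h := fun y => -F y) (fun x hx => (hF2 x hx).neg)
    (fun x hx => by
      have := lap_const_mul (-1) (hF2 x hx)
      simpa only [neg_one_mul, hFl x hx, neg_zero] using this) hC fun x hx hxc =>
    (neg_le_abs _).trans (hCF x hx hxc)
  filter_upwards [hFu] with x hx hxΩ
  rw [← hx hxΩ]
  exact le_antisymm (h1 x hxΩ) (by linarith [h2 x hxΩ])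

/-- A function with zero trace which is harmonic off an interior point has a representative off
that point which extends continuously by zero across the boundary. -/
theorem exists_continuousOn_of_weaklyHarmonic (hφ : IsBarrier Ω φ c) (ho : IsOpen Ω)
    (hb : Bornology.IsBounded Ω) {x₀ : Plane} (hx₀ : x₀ ∈ Ω) {u : Plane → ℝ} (hu : Integrable u)
    (htr : ZeroTrace Ω φ u) (hw : WeaklyHarmonic (Ω \ {x₀}) u) :
    ∃ F : Plane → ℝ, (∀ᵐ x, x ∈ Ω → x ≠ x₀ → F x = u x) ∧ (∀ x ∉ Ω, F x = 0) ∧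
      ContinuousOn F (closure Ω \ {x₀}) := by
  have ho' : IsOpen (Ω \ {x₀}) := ho.sdiff isClosed_singleton
  obtain ⟨G, hG, hGu, hGl⟩ := hw.exists_harmonic ho' hu
  -- The divisor $3$ puts $x_0$ in $\{\varphi>2a\}$, where the cutoff $\eta$ vanishes.
  set a := min c (φ x₀ / 3) with ha
  have hp := hφ.pos x₀ hx₀
  have ha0 : 0 < a := lt_min hφ.level_pos (by linarith)
  have hφa := hφ.mono ha0 (min_le_left _ _)
  have ha3 : a ≤ φ x₀ / 3 := min_le_right _ _
  set η : Plane → ℝ := fun x => 1 - Real.smoothTransition (φ x / a - 1) with hη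
  have hηs : ContDiff ℝ 2 η := contDiff_const.sub
    (Real.smoothTransition.contDiff.comp (((hφ.smooth.of_le (by norm_cast)).div_const a).sub
      contDiff_const))
  have hη1 : ∀ x, φ x < a → η x = 1 := fun x hx => by
    have : φ x / a < 1 := (div_lt_one ha0).2 hx
    simp only [hη]
    rw [Real.smoothTransition.zero_of_nonpos (by linarith), sub_zero]
  have hη0 : ∀ x, 2 * a < φ x → η x = 0 := fun x hx => by
    have : 2 < φ x / a := (lt_div_iff₀ ha0).2 hx
    simp only [hη]
    rw [Real.smoothTransition.one_of_one_le (by linarith), sub_self]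
  have hne : ∀ x, φ x < a → x ≠ x₀ := by
    rintro x hx rfl
    linarith
  -- Cutting off removes the possible singularity at $x_0$, so $h$ is $C^2$ throughout $\Omega$ and
  -- unchanged near the boundary; the decay estimate needs nothing more.
  set h : Plane → ℝ := fun x => η x * G x with hh
  have hnear : ∀ x, φ x < a → h =ᶠ[𝓝 x] G := fun x hx => by
    filter_upwards [hφ.smooth.continuous.continuousAt.eventually_lt_const hx] with y hy
    simp only [hh, hη1 y hy, one_mul]
  obtain ⟨C, hC, hCh⟩ := hφa.abs_le_mul_of_zeroTrace ho hb (h := h) (u := u)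
    (fun x hx => by
      by_cases hxx : x = x₀
      · refine (contDiffAt_const (c := (0 : ℝ))).congr_of_eventuallyEq ?_
        have : 2 * a < φ x := by rw [hxx]; linarith
        filter_upwards [hφ.smooth.continuous.continuousAt.eventually_const_lt this] with y hy
        simp only [hh, hη0 y hy, zero_mul]
      · exact hηs.contDiffAt.mul ((hG x ⟨hx, hxx⟩).of_le (by norm_cast)))
    (fun x hx hxa => by
      rw [(Filter.EventuallyEq.laplacian (hnear x hxa)).eq_of_nhds]
      exact hGl x ⟨hx, hne x hxa⟩)
    hu.integrableOn htr (hGu.mono fun x hx h1 h2 => by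
      rw [(hnear x h2).eq_of_nhds]
      exact hx ⟨h1, hne x h2⟩)
  refine ⟨Ω.indicator G, ?_, fun x hx => Set.indicator_of_notMem hx _, fun x hx => ?_⟩
  · filter_upwards [hGu] with x hx h1 h2
    rw [Set.indicator_of_mem h1]
    exact hx ⟨h1, h2⟩
  · by_cases hxΩ : x ∈ Ω
    · refine ((hG x ⟨hxΩ, hx.2⟩).continuousAt.congr ?_).continuousWithinAt
      filter_upwards [ho.mem_nhds hxΩ] with y hy
      exact (Set.indicator_of_mem hy _).symm
    · have hfr : x ∈ frontier Ω := ⟨hx.1, by rwa [ho.interior_eq]⟩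
      have hφx := hφ.eq_zero x hfr
      rw [ContinuousWithinAt, Set.indicator_of_notMem hxΩ]
      have hlim : Tendsto (fun y => C * φ y) (𝓝[closure Ω \ {x₀}] x) (𝓝 0) := by
        have := (hφ.smooth.continuous.tendsto x).const_mul C
        rw [hφx, mul_zero] at this
        exact this.mono_left nhdsWithin_le_nhds
      refine squeeze_zero_norm' ?_ hlim
      have hlt : φ x < a := by rwa [hφx]
      filter_upwards [self_mem_nhdsWithin, nhdsWithin_le_nhds
        (hφ.smooth.continuous.continuousAt.eventually_lt_const hlt)] with y hy hya
      by_cases hyΩ : y ∈ Ω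
      · rw [Set.indicator_of_mem hyΩ, ← (hnear y hya).eq_of_nhds]
        exact hCh y hyΩ hya
      · rw [Set.indicator_of_notMem hyΩ, norm_zero,
          hφ.eq_zero y ⟨hy.1, by rwa [ho.interior_eq]⟩, mul_zero]

end IsBarrier

/-! ### Comparison of the two solutions -/

theorem IsDiracSolution.integral_mul_lap {p : ℝ≥0∞} {Ω : TopologicalSpace.Opens Plane}
    {x₀ : Plane} {u : Plane → ℝ} (h : IsDiracSolution p Ω x₀ u) (hp : 1 ≤ p)
    (hb : Bornology.IsBounded (Ω : Set Plane)) {ψ : Plane → ℝ} (hψ : ContDiff ℝ ∞ ψ)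
    (hψc : HasCompactSupport ψ) (hψΩ : tsupport ψ ⊆ Ω) :
    ∫ x in (Ω : Set Plane), u x * lap ψ x = -ψ x₀ := by
  obtain ⟨g, hg, hsol⟩ := h
  exact (hg.toHasSobolevGradient.integral_mul_lap hp hb ⟨ψ, hψ, hψc, hψΩ⟩).trans
    (congrArg Neg.neg (hsol ⟨ψ, hψ, hψc, hψΩ⟩))

theorem IsPoissonSolution.integral_mul_lap {Ω : TopologicalSpace.Opens Plane}
    {f u : Plane → ℝ} (h : IsPoissonSolution Ω f u)
    (hb : Bornology.IsBounded (Ω : Set Plane)) {ψ : Plane → ℝ} (hψ : ContDiff ℝ ∞ ψ)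
    (hψc : HasCompactSupport ψ) (hψΩ : tsupport ψ ⊆ Ω) :
    ∫ x in (Ω : Set Plane), u x * lap ψ x = -∫ x, f x * ψ x := by
  obtain ⟨g, hg, hsol⟩ := h
  have e := (hg.toHasSobolevGradient.integral_mul_lap one_le_two hb ⟨ψ, hψ, hψc, hψΩ⟩).trans
    (congrArg Neg.neg (hsol ⟨ψ, hψ, hψc, hψΩ⟩))
  have e2 : ∫ x in (Ω : Set Plane), f x * ψ x = ∫ x, f x * ψ x :=
    setIntegral_eq_integral_of_forall_compl_eq_zero fun x hx => by
      rw [image_eq_zero_of_notMem_tsupport fun h => hx (hψΩ h), mul_zero]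
  rw [← e2]
  exact e

theorem theorem3 (Ω : TopologicalSpace.Opens Plane)
    (hbdd : Bornology.IsBounded (Ω : Set Plane))
    (hΩ : HasSmoothBoundary (Ω : Set Plane) ∨ IsOpenSquare (Ω : Set Plane))
    (x₀ : Plane) (ε : ℝ) (hε : 0 < ε)
    (hball : Metric.closedBall x₀ ε ⊆ (Ω : Set Plane))
    (p : ℝ≥0∞) (hp₁ : 1 ≤ p) (hp₂ : p < 2)
    (uδ uε : Plane → ℝ)
    (hδ : IsDiracSolution p Ω x₀ uδ)
    (hsol : IsPoissonSolution Ω (ballBump x₀ ε) uε) :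
    ∃ vδ vε : Plane → ℝ,
      vδ =ᵐ[volume.restrict (Ω : Set Plane)] uδ ∧
      vε =ᵐ[volume.restrict (Ω : Set Plane)] uε ∧
      ContinuousOn vδ (closure (Ω : Set Plane) \ Metric.ball x₀ ε) ∧
      ContinuousOn vε (closure (Ω : Set Plane) \ Metric.ball x₀ ε) ∧
      (∀ x ∈ frontier (Ω : Set Plane), vδ x = 0 ∧ vε x = 0) ∧
      Set.EqOn vδ vε (closure (Ω : Set Plane) \ Metric.ball x₀ ε) := by
  have ho : IsOpen (Ω : Set Plane) := Ω.isOpen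
  have hm : MeasurableSet (Ω : Set Plane) := ho.measurableSet
  have hfin : IsFiniteMeasure (volume.restrict (Ω : Set Plane)) :=
    ⟨by simpa using hbdd.measure_lt_top⟩
  have hx₀ : x₀ ∈ (Ω : Set Plane) := hball (Metric.mem_closedBall_self hε.le)
  obtain ⟨φ, c, hφ⟩ : ∃ φ c, IsBarrier (Ω : Set Plane) φ c :=
    hΩ.elim (fun h => h.exists_isBarrier ho hbdd) fun h => h.exists_isBarrier
  obtain ⟨w, hwi, hw0, hwl⟩ := exists_potential_ballBump x₀ hε
  have htδ : IsBarrier.ZeroTrace (Ω : Set Plane) φ uδ :=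
    let ⟨_, hg, _⟩ := hδ; hg.zeroTrace hp₁ hbdd hφ
  have htε : IsBarrier.ZeroTrace (Ω : Set Plane) φ uε :=
    let ⟨_, hg, _⟩ := hsol; hg.zeroTrace one_le_two hbdd hφ
  have hiδ : IntegrableOn uδ (Ω : Set Plane) :=
    let ⟨_, hg, _⟩ := hδ; hg.memLp.integrable hp₁
  have hiε : IntegrableOn uε (Ω : Set Plane) :=
    let ⟨_, hg, _⟩ := hsol; hg.memLp.integrable one_le_two
  set U : Plane → ℝ := (Ω : Set Plane).indicator uδ with hU
  -- The correction exchanges the source $f_\varepsilon$ for $\delta_{x_0}$ and changes nothing off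
  -- the ball.
  set V : Plane → ℝ := fun x => (Ω : Set Plane).indicator uε x + w x with hV
  have hUi : Integrable U := hiδ.integrable_indicator hm
  have hεi : Integrable ((Ω : Set Plane).indicator uε) := hiε.integrable_indicator hm
  have hVi : Integrable V := hεi.add hwi
  have hind : ∀ (u ψ : Plane → ℝ), ∫ x, (Ω : Set Plane).indicator u x * lap ψ x =
      ∫ x in (Ω : Set Plane), u x * lap ψ x := fun u ψ => by
    rw [← integral_indicator hm]
    simp only [Set.indicator_mul_left]
  have hUl : ∀ ψ : Plane → ℝ, ContDiff ℝ ∞ ψ → HasCompactSupport ψ →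
      tsupport ψ ⊆ (Ω : Set Plane) → ∫ x, U x * lap ψ x = -ψ x₀ := fun ψ h1 h2 h3 => by
    rw [hU, hind, hδ.integral_mul_lap hp₁ hbdd h1 h2 h3]
  have hmul : ∀ {u ψ : Plane → ℝ}, Integrable u → ContDiff ℝ ∞ ψ → HasCompactSupport ψ →
      Integrable fun x => u x * lap ψ x := fun {u ψ} hu h1 h2 => by
    obtain ⟨N, _, hN⟩ := exists_bound_of_compactSupport h1.laplacian_infty.continuous h2.laplacian
    exact hu.mul_bdd (c := N) h1.laplacian_infty.continuous.aestronglyMeasurable (ae_of_all _ hN)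
  have hVl : ∀ ψ : Plane → ℝ, ContDiff ℝ ∞ ψ → HasCompactSupport ψ →
      tsupport ψ ⊆ (Ω : Set Plane) → ∫ x, V x * lap ψ x = -ψ x₀ := fun ψ h1 h2 h3 => by
    simp only [hV, add_mul]
    rw [integral_add (hmul hεi h1 h2) (hmul hwi h1 h2), hind, hwl ψ h1 h2,
      hsol.integral_mul_lap hbdd h1 h2 h3]
    ring
  have hUt : IsBarrier.ZeroTrace (Ω : Set Plane) φ U := htδ.congr ho
    (Eventually.of_forall fun t x hx _ => (Set.indicator_of_mem hx _).symm)
  -- The barrier is bounded below on the closed ball, so thin layers do not meet the support of $w$.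
  have hVt : IsBarrier.ZeroTrace (Ω : Set Plane) φ V := by
    refine htε.congr ho ?_
    obtain ⟨r, hr, hr'⟩ := (isCompact_closedBall x₀ ε).exists_forall_le'
      hφ.smooth.continuous.continuousOn (a := 0) fun x hx => hφ.pos x (hball hx)
    filter_upwards [Ioo_mem_nhdsGT (half_pos hr)] with t ht x hx hxw
    have hxb : x ∉ Metric.ball x₀ ε := fun hxb => hxw <| layerWeight_eq_zero ht.1 <| by
      linarith [ht.2, hr' x (Metric.ball_subset_closedBall hxb)]
    simp only [hV, Set.indicator_of_mem hx, hw0 x hxb, add_zero]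
  have hUV : ∀ᵐ x, x ∈ (Ω : Set Plane) → U x - V x = 0 := by
    refine hφ.ae_eq_zero_of_weaklyHarmonic ho hbdd (hUi.sub hVi)
      (hUt.sub hφ ho hbdd hUi.integrableOn hVi.integrableOn hVt) fun ψ h1 h2 h3 => ?_
    simp only [sub_mul]
    rw [integral_sub (hmul hUi h1 h2) (hmul hVi h1 h2), hUl ψ h1 h2 h3, hVl ψ h1 h2 h3, sub_self]
  obtain ⟨F, hFU, hF0, hFc⟩ := hφ.exists_continuousOn_of_weaklyHarmonic ho hbdd hx₀ hUi hUt
    fun ψ h1 h2 h3 => by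
      rw [hUl ψ h1 h2 (h3.trans Set.sdiff_subset), image_eq_zero_of_notMem_tsupport fun h =>
        (h3 h).2 rfl, neg_zero]
  have hx₀b : x₀ ∈ Metric.ball x₀ ε := Metric.mem_ball_self hε
  have hFc' : ContinuousOn F (closure (Ω : Set Plane) \ Metric.ball x₀ ε) :=
    hFc.mono (Set.sdiff_subset_sdiff_right (Set.singleton_subset_iff.2 hx₀b))
  classical
  -- Both representatives share the same continuous $F$ off the ball, so their equality there is
  -- immediate; inside the ball each keeps its own values, since no regularity is claimed there.
  set v : (Plane → ℝ) → Plane → ℝ := fun u => (Metric.ball x₀ ε).piecewise u F with hv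
  have hvF : ∀ u, Set.EqOn (v u) F (closure (Ω : Set Plane) \ Metric.ball x₀ ε) := fun u x hx =>
    Set.piecewise_eq_of_notMem _ _ _ hx.2
  have hvfr : ∀ u, ∀ x ∈ frontier (Ω : Set Plane), v u x = 0 := fun u x hx => by
    have hxΩ : x ∉ (Ω : Set Plane) := fun h => hx.2 (by rwa [ho.interior_eq])
    have hxb : x ∉ Metric.ball x₀ ε := fun h => hxΩ (hball (Metric.ball_subset_closedBall h))
    rw [hvF u ⟨hx.1, hxb⟩, hF0 x hxΩ]
  refine ⟨v uδ, v uε, (ae_restrict_iff' hm).2 ?_, (ae_restrict_iff' hm).2 ?_,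
    hFc'.congr (hvF uδ), hFc'.congr (hvF uε), fun x hx => ⟨hvfr uδ x hx, hvfr uε x hx⟩,
    (hvF uδ).trans (hvF uε).symm⟩
  · filter_upwards [hFU] with x hx hxΩ
    by_cases hxb : x ∈ Metric.ball x₀ ε
    · exact Set.piecewise_eq_of_mem _ _ _ hxb
    · rw [hvF uδ ⟨subset_closure hxΩ, hxb⟩, hx hxΩ fun h => hxb (h ▸ hx₀b), hU,
        Set.indicator_of_mem hxΩ]
  · filter_upwards [hFU, hUV] with x hx hxUV hxΩ
    by_cases hxb : x ∈ Metric.ball x₀ ε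
    · exact Set.piecewise_eq_of_mem _ _ _ hxb
    · rw [hvF uε ⟨subset_closure hxΩ, hxb⟩, hx hxΩ fun h => hxb (h ▸ hx₀b),
        sub_eq_zero.1 (hxUV hxΩ), hV]
      simp only [Set.indicator_of_mem hxΩ, hw0 x hxb, add_zero]
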